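/- Let $\mathcal B:D(\mathcal B)\subseteq X\to X$ be a linear operator on a complex Banach space $X$ (not necessarily bounded or densely defined). Let $\omega\in(0,\pi)$, $\lambda_0>0$ and $\Sigma_\omega=\{z\in\mathbb C:\pi-|\arg z|<\omega\}$. Suppose that the resolvent set of $\mathcal B$ contains $\Sigma_\omega\cup\{z:|z|<\lambda_0\}$, and that $z(z\mathcal I-\mathcal B)^{-1}$ is bounded on every smaller sector: for each $\eta\in(0,\omega)$, $\sup_{z\in\Sigma_\eta}\|z(z\mathcal I-\mathcal B)^{-1}\|<\infty$. Let $\alpha\in(0,1)$. The power $\mathcal B^\alpha$ is defined by the Dunford–Taylor integral of $z^\alpha$ (principal branch) in its usual regularized form $$\mathcal B^\alpha=\mathcal B\,\mathcal B^{\alpha-1},\qquad \mathcal B^{\alpha-1}=\frac1{2\pi\mathrm i}\int_{\mathcal C}z^{\alpha-1}(z\mathcal I-\mathcal B)^{-1}\,dz,\qquad D(\mathcal B^\alpha)=\{x\in X:\mathcal B^{\alpha-1}x\in D(\mathcal B)\},$$ where $\mathcal C=\mathcal C_{\delta,\theta}$ comes in from infinity along the ray $\arg z=\theta$ down to $|z|=\delta$,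 follows the circle $|z|=\delta$ clockwise to $\arg z=-\theta$, and goes out to infinity along the ray $\arg z=-\theta$, with $0<\delta<\lambda_0$ and $\pi-\omega<\theta<\pi$. Then, for every such choice of $\delta$ and $\theta$, the integral defining $\mathcal B^{\alpha-1}$ converges absolutely in operator norm, and for every $t\ge 0$ the operator $\mathcal B^\alpha+t\mathcal I:D(\mathcal B^\alpha)\to X$ has an everywhere defined bounded inverse, given by $$(\mathcal B^\alpha+t\mathcal I)^{-1}=\frac{\sin\pi\alpha}{\pi}\int_0^\infty(\rho+\mathcal B)^{-1}\,\frac{\rho^\alpha}{\rho^{2\alpha}+2t\rho^\alpha\cos\pi\alpha+t^2}\,d\rho ,$$ where the integral converges absolutely in operator norm. For $t=0$ this is the Balakrishnan formula $$(\mathcal B^\alpha)^{-1}=\frac{\sin\pi\alpha}{\pi}\int_0^\infty\rho^{-\alpha}(\rho+\mathcal B)^{-1}\,d\rho .$$ -/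

import Mathlib

open Set MeasureTheory

namespace UnboundedOp

variable {X : Type*} [NormedAddCommGroup X] [NormedSpace ℂ X]

/-- The operator `z I + T`, with domain `D(T)`. -/
noncomputable def addScalar (z : ℂ) (T : X →ₗ.[ℂ] X) : X →ₗ.[ℂ] X :=
  (z • (LinearMap.id : X →ₗ[ℂ] X)) +ᵥ T

/-- `R` is a bounded, everywhere defined inverse of the operator `T : D(T) → X`:
`R` maps `X` into `D(T)`, `T R = I` on `X` and `R T = I` on `D(T)`. -/
def IsBoundedInverse (T : X →ₗ.[ℂ] X) (R : X →L[ℂ] X) : Prop :=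
  (∀ x : X, ∃ h : R x ∈ T.domain, T ⟨R x, h⟩ = x) ∧ ∀ x : T.domain, R (T x) = (x : X)

/-- A bounded inverse is unique. -/
theorem IsBoundedInverse.unique {T : X →ₗ.[ℂ] X} {R S : X →L[ℂ] X}
    (hR : IsBoundedInverse T R) (hS : IsBoundedInverse T S) : R = S := by
  ext x
  obtain ⟨h, hx⟩ := hR.1 x
  have h2 := hS.2 ⟨R x, h⟩
  rw [hx] at h2
  exact h2.symm

open Classical in
/-- The bounded inverse `T⁻¹` (the zero operator when there is none). -/
noncomputable def boundedInverse (T : X →ₗ.[ℂ] X) : X →L[ℂ] X :=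
  if h : ∃ R : X →L[ℂ] X, IsBoundedInverse T R then h.choose else 0

theorem IsBoundedInverse.boundedInverse_eq {T : X →ₗ.[ℂ] X} {R : X →L[ℂ] X}
    (hR : IsBoundedInverse T R) : boundedInverse T = R := by
  have h : ∃ R : X →L[ℂ] X, IsBoundedInverse T R := ⟨R, hR⟩
  rw [boundedInverse, dif_pos h]
  exact h.choose_spec.unique hR

/-- The resolvent set of `B`: all `z` for which `z I - B` has a bounded inverse. -/
def resolventSetOf (B : X →ₗ.[ℂ] X) : Set ℂ :=
  {z | ∃ R : X →L[ℂ] X, IsBoundedInverse (addScalar z (-B)) R}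

/-- The resolvent `(z I - B)⁻¹`. -/
noncomputable def resolventOf (B : X →ₗ.[ℂ] X) (z : ℂ) : X →L[ℂ] X :=
  boundedInverse (addScalar z (-B))

/-- The sector `Σ_ω = {z : π - |arg z| < ω}` around the negative real axis. -/
def negSector (ω : ℝ) : Set ℂ := {z | Real.pi - |z.arg| < ω}

section Contour

variable {E : Type*} [NormedAddCommGroup E] [NormedSpace ℂ E]

/-- The point of modulus `r` on the ray with angle `φ`. -/
noncomputable def rayPoint (r φ : ℝ) : ℂ := (r : ℂ) * Complex.exp ((φ : ℂ) * Complex.I)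

/-- The integral `∫ F(z) dz` along the contour that comes in along the ray `arg z = θ` from infinity
to modulus `δ`, follows the circle `|z| = δ` clockwise from angle `θ` to angle `-θ`, and
goes out to infinity along the ray `arg z = -θ`. -/
noncomputable def keyholeIntegral (δ θ : ℝ) (F : ℂ → E) : E :=
  -(∫ r in Ioi δ, Complex.exp ((θ : ℂ) * Complex.I) • F (rayPoint r θ))
    + (∫ φ in θ..(-θ), (Complex.I * rayPoint δ φ) • F (rayPoint δ φ))
    + ∫ r in Ioi δ, Complex.exp (((-θ : ℝ) : ℂ) * Complex.I) • F (rayPoint r (-θ))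

/-- Absolute convergence of the integral along the same contour. -/
def KeyholeIntegrable (δ θ : ℝ) (F : ℂ → E) : Prop :=
  IntegrableOn (fun r : ℝ => F (rayPoint r θ)) (Ioi δ) ∧
  IntervalIntegrable (fun φ : ℝ => F (rayPoint δ φ)) volume θ (-θ) ∧
  IntegrableOn (fun r : ℝ => F (rayPoint r (-θ))) (Ioi δ)

end Contour

/-- The Dunford-Taylor integral `(2πi)⁻¹ ∫ z ^ s (z I - B)⁻¹ dz` over the contour of `keyholeIntegral`,
with the principal branch of `z ^ s`. -/
noncomputable def dunfordTaylor (B : X →ₗ.[ℂ] X) (δ θ s : ℝ) : X →L[ℂ] X :=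
  (2 * (Real.pi : ℂ) * Complex.I)⁻¹ •
    keyholeIntegral δ θ (fun z : ℂ => z ^ (s : ℂ) • resolventOf B z)

/-- The fractional power `B^α`, `0 < α < 1`: the Dunford-Taylor integral of `z ^ α`, read in the usual
regularized way as `B^α = B B^(α-1)` with the absolutely convergent integral
`B^(α-1) = (2πi)⁻¹ ∫ z ^ (α - 1) (z I - B)⁻¹ dz`. Its domain is the natural one,
`D(B^α) = {x : B^(α-1) x ∈ D(B)}`. -/
noncomputable def fracPower (B : X →ₗ.[ℂ] X) (δ θ α : ℝ) : X →ₗ.[ℂ] X where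
  domain := B.domain.comap (dunfordTaylor B δ θ (α - 1) : X →ₗ[ℂ] X)
  toFun := B.toFun ∘ₗ
    (dunfordTaylor B δ θ (α - 1) : X →ₗ[ℂ] X).restrict (fun _ hx => hx)

theorem fracPower_apply (B : X →ₗ.[ℂ] X) (δ θ α : ℝ) (x : (fracPower B δ θ α).domain) :
    fracPower B δ θ α x = B ⟨dunfordTaylor B δ θ (α - 1) (x : X), x.2⟩ := rfl

end UnboundedOp

/-!
Cutting the plane along the negative real axis, the Cauchy formula represents
`f z = (z ^ α + t)⁻¹` by its jump across the cut:
`f z = (sin πα / π) ∫ k(ρ) (z + ρ)⁻¹ dρ`, `k(ρ) = ρ ^ α / (ρ ^ (2α) + 2 t ρ ^ α cos πα + t ^ 2)`.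
Let `R = (sin πα / π) ∫ k(ρ) (ρ + B)⁻¹ dρ`. The resolvent identity
`(z - B)⁻¹ (ρ + B)⁻¹ = (z + ρ)⁻¹ ((z - B)⁻¹ + (ρ + B)⁻¹)` gives
`(z - B)⁻¹ R = f z • (z - B)⁻¹ + H z`, where `H` is holomorphic off the negative real axis and
`O(‖z‖⁻¹)` to the right of the contour. Now multiply by `g z = z ^ (α - 1) + t z⁻¹`, for which
`g z * f z = z⁻¹`, and integrate over the contour. On the left this yields
`(B ^ (α - 1) + t B⁻¹) R`; on the right the term with `H` vanishes, by closing the contour to the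
right, and `z⁻¹ (z - B)⁻¹` contributes `B⁻¹`, by closing it to the left around the pole at the
origin. Hence `(B ^ (α - 1) + t B⁻¹) R = B⁻¹`, and since all these operators commute, `R` inverts
`B ^ α + t = B (B ^ (α - 1) + t B⁻¹)`.
-/

namespace UnboundedOp

section Operators

variable {X : Type*} [NormedAddCommGroup X] [NormedSpace ℂ X] {T B : X →ₗ.[ℂ] X} {R S : X →L[ℂ] X}

theorem addScalar_apply (z : ℂ) (x : (addScalar z T).domain) :
    addScalar z T x = z • (x : X) + T ⟨x, x.2⟩ := rfl

theorem addScalar_zero (T : X →ₗ.[ℂ] X) : addScalar 0 T = T := by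
  rw [addScalar, zero_smul, zero_vadd]

theorem addScalar_add (z w : ℂ) (T : X →ₗ.[ℂ] X) :
    addScalar (z + w) T = addScalar z (addScalar w T) := by
  simp only [addScalar, add_smul, add_vadd]

theorem neg_addScalar (z : ℂ) (T : X →ₗ.[ℂ] X) : -addScalar z T = addScalar (-z) (-T) :=
  LinearPMap.ext rfl fun x hx hx' => by
    change -(z • x + T ⟨x, hx⟩) = -z • x + -T ⟨x, hx⟩
    rw [neg_add, neg_smul]

namespace IsBoundedInverse

theorem boundedInverse (h : ∃ R, IsBoundedInverse T R) :
    IsBoundedInverse T (boundedInverse T) := by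
  obtain ⟨R, hR⟩ := h
  rwa [hR.boundedInverse_eq]

theorem injective (hR : IsBoundedInverse T R) : Function.Injective R := fun x y hxy => by
  obtain ⟨hx, hx'⟩ := hR.1 x
  obtain ⟨hy, hy'⟩ := hR.1 y
  rw [← hx', ← hy']
  exact congrArg T (Subtype.ext hxy)

theorem neg (hR : IsBoundedInverse T R) : IsBoundedInverse (-T) (-R) := by
  refine ⟨fun x => ?_, fun x => ?_⟩
  · obtain ⟨hx, hx'⟩ := hR.1 (-x)
    refine ⟨by simpa using hx, ?_⟩
    rw [LinearPMap.neg_apply, neg_eq_iff_eq_neg]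
    exact (congrArg T (Subtype.ext (by simp))).trans hx'
  · rw [LinearPMap.neg_apply, neg_apply, map_neg, neg_neg]
    exact hR.2 x

theorem sub_eq_smul_mul {c : ℂ} (hR : IsBoundedInverse T R)
    (hS : IsBoundedInverse (addScalar c T) S) : R - S = c • (R * S) := by
  ext x
  obtain ⟨h, hx⟩ := hS.1 x
  have hSx : R (T ⟨S x, h⟩) = S x := hR.2 ⟨S x, h⟩
  rw [addScalar_apply] at hx
  simp only [sub_apply, smul_apply, mul_apply_eq_comp]
  nth_rw 1 [← hx]
  rw [map_add, map_smul, hSx, add_sub_cancel_right]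

theorem commute {c : ℂ} (hR : IsBoundedInverse T R) (hS : IsBoundedInverse (addScalar c T) S) :
    Commute R S := by
  rcases eq_or_ne c 0 with rfl | hc
  · rw [addScalar_zero] at hS
    exact hR.unique hS ▸ Commute.refl R
  · have hT : IsBoundedInverse (addScalar (-c) (addScalar c T)) R := by
      rwa [← addScalar_add, neg_add_cancel, addScalar_zero]
    refine smul_right_injective _ hc (?_ : c • (R * S) = c • (S * R))
    rw [← hR.sub_eq_smul_mul hS, ← neg_sub, hS.sub_eq_smul_mul hT, neg_smul, neg_neg]

theorem addScalar_of_isUnit {c : ℂ} (hR : IsBoundedInverse T R) (hU : IsUnit (1 + c • R)) :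
    IsBoundedInverse (addScalar c T) (R * Ring.inverse (1 + c • R)) := by
  set U := 1 + c • R
  have hUR (x : X) : U (Ring.inverse U x) = x := DFunLike.congr_fun (Ring.mul_inverse_cancel U hU) x
  have hRU (x : X) : Ring.inverse U (U x) = x := DFunLike.congr_fun (Ring.inverse_mul_cancel U hU) x
  have hTR (y : X) (h : R y ∈ T.domain) : addScalar c T ⟨R y, h⟩ = U y := by
    have hTy : T ⟨R y, h⟩ = y := (hR.1 y).2
    exact (congrArg (c • R y + ·) hTy).trans (add_comm _ _)
  refine ⟨fun x => ?_, fun x => ?_⟩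
  · have h := (hR.1 (Ring.inverse U x)).1
    exact ⟨h, (hTR _ h).trans (hUR x)⟩
  · have hx : R (T x) = x := hR.2 x
    have h : R (T x) ∈ T.domain := hx ▸ x.2
    have hxx : x = (⟨R (T x), h⟩ : T.domain) := Subtype.ext hx.symm
    change R (Ring.inverse U (addScalar c T x)) = x
    rw [show addScalar c T x = U (T x) from (congrArg _ hxx).trans (hTR _ h), hRU, hx]

theorem addScalar_fracPower {δ θ α : ℝ} {t : ℂ} {A : X →L[ℂ] X} (hA : IsBoundedInverse B A)
    (hmul : (dunfordTaylor B δ θ (α - 1) + t • A) * R = A)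
    (hS : Commute (dunfordTaylor B δ θ (α - 1)) R) (hAR : Commute A R) :
    IsBoundedInverse (addScalar t (fracPower B δ θ α)) R := by
  set S := dunfordTaylor B δ θ (α - 1)
  have hmul' : R * (S + t • A) = A := (hS.add_left (hAR.smul_left t)).eq.symm.trans hmul
  refine ⟨fun x => ?_, fun x => hA.injective ?_⟩
  · have hSR : S (R x) = A (x - t • R x) := by
      have h := DFunLike.congr_fun hmul x
      simp only [mul_apply_eq_comp, add_apply, smul_apply] at h
      rw [map_sub, map_smul, ← h, add_sub_cancel_right]
    obtain ⟨h, hx⟩ := hA.1 (x - t • R x)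
    have hmem : S (R x) ∈ B.domain := hSR ▸ h
    have hBS : fracPower B δ θ α ⟨R x, hmem⟩ = x - t • R x :=
      (congrArg B (Subtype.ext hSR)).trans hx
    exact ⟨hmem, (congrArg (t • R x + ·) hBS).trans (add_sub_cancel _ _)⟩
  · have hAB : A (fracPower B δ θ α x) = S x := hA.2 ⟨S x, x.2⟩
    have hAx : A (addScalar t (fracPower B δ θ α) x) = (S + t • A) x := by
      rw [addScalar_apply, map_add, map_smul]
      exact (congrArg (t • A x + ·) hAB).trans (add_comm _ _)
    rw [← mul_apply_eq_comp, hAR.eq, mul_apply_eq_comp, hAx]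
    exact DFunLike.congr_fun hmul' (x : X)

end IsBoundedInverse

theorem isBoundedInverse_resolventOf {z : ℂ} (hz : z ∈ resolventSetOf B) :
    IsBoundedInverse (addScalar z (-B)) (resolventOf B z) :=
  .boundedInverse hz

theorem isBoundedInverse_neg_resolventOf_neg {z : ℂ} (hz : -z ∈ resolventSetOf B) :
    IsBoundedInverse (addScalar z B) (-resolventOf B (-z)) := by
  simpa only [neg_addScalar, neg_neg] using (isBoundedInverse_resolventOf hz).neg

theorem boundedInverse_addScalar {z : ℂ} (hz : -z ∈ resolventSetOf B) :
    boundedInverse (addScalar z B) = -resolventOf B (-z) :=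
  (isBoundedInverse_neg_resolventOf_neg hz).boundedInverse_eq

theorem isBoundedInverse_addScalar_sub {z w : ℂ} (hw : w ∈ resolventSetOf B) :
    IsBoundedInverse (addScalar (w - z) (addScalar z (-B))) (resolventOf B w) := by
  rw [← addScalar_add, sub_add_cancel]
  exact isBoundedInverse_resolventOf hw

theorem resolventOf_sub {z w : ℂ} (hz : z ∈ resolventSetOf B) (hw : w ∈ resolventSetOf B) :
    resolventOf B z - resolventOf B w = (w - z) • (resolventOf B z * resolventOf B w) :=
  (isBoundedInverse_resolventOf hz).sub_eq_smul_mul (isBoundedInverse_addScalar_sub hw)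

theorem commute_resolventOf {z w : ℂ} (hz : z ∈ resolventSetOf B) (hw : w ∈ resolventSetOf B) :
    Commute (resolventOf B z) (resolventOf B w) :=
  (isBoundedInverse_resolventOf hz).commute (isBoundedInverse_addScalar_sub hw)

theorem resolventOf_mul_boundedInverse_addScalar {z w : ℂ} (hz : z ∈ resolventSetOf B)
    (hw : -w ∈ resolventSetOf B) (hzw : z + w ≠ 0) :
    resolventOf B z * boundedInverse (addScalar w B)
      = (z + w)⁻¹ • (resolventOf B z + boundedInverse (addScalar w B)) := by
  rw [boundedInverse_addScalar hw, ← sub_eq_add_neg, resolventOf_sub hz hw, ← neg_add', mul_neg,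
    neg_smul, smul_neg, add_comm w, inv_smul_smul₀ hzw]

theorem differentiableAt_resolventOf [CompleteSpace X] {z : ℂ} (hz : z ∈ resolventSetOf B) :
    DifferentiableAt ℂ (resolventOf B) z := by
  let U : ℂ → X →L[ℂ] X := fun w => 1 + (w - z) • resolventOf B z
  have hUd : DifferentiableAt ℂ U z := by fun_prop
  have hUz : U z = 1 := by simp only [U, sub_self, zero_smul, add_zero]
  have hinv : DifferentiableAt ℂ Ring.inverse (U z) :=
    hUz ▸ differentiableAt_inverse (𝕜 := ℂ) isUnit_one
  have hunit : ∀ᶠ w in nhds z, IsUnit (U w) :=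
    hUd.continuousAt.eventually (by rw [hUz]; exact Units.isOpen.mem_nhds isUnit_one)
  refine ((differentiableAt_const (resolventOf B z)).mul (hinv.comp z hUd)).congr_of_eventuallyEq ?_
  filter_upwards [hunit] with w hw
  have h := (isBoundedInverse_resolventOf hz).addScalar_of_isUnit hw
  rw [← addScalar_add, sub_add_cancel] at h
  exact h.boundedInverse_eq

end Operators

section Polar

theorem exp_ofReal_add_mul_I (x φ : ℝ) :
    Complex.exp (x + φ * Complex.I) = rayPoint (Real.exp x) φ := by
  rw [Complex.exp_add, ← Complex.ofReal_exp, rayPoint]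

theorem circleMap_zero_eq_rayPoint (r φ : ℝ) : circleMap 0 r φ = rayPoint r φ := zero_add _

theorem norm_rayPoint {r : ℝ} (hr : 0 ≤ r) (φ : ℝ) : ‖rayPoint r φ‖ = r := by
  rw [← circleMap_zero_eq_rayPoint, norm_circleMap_zero, abs_of_nonneg hr]

theorem rayPoint_norm_arg (z : ℂ) : rayPoint ‖z‖ z.arg = z := Complex.norm_mul_exp_arg_mul_I z

theorem rayPoint_periodic (r : ℝ) : (rayPoint r).Periodic (2 * Real.pi) := fun φ => by
  simp only [← circleMap_zero_eq_rayPoint, periodic_circleMap 0 r φ]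

theorem rayPoint_pi (r : ℝ) : rayPoint r Real.pi = -r := by
  rw [rayPoint, Complex.exp_pi_mul_I, mul_neg_one]

theorem rayPoint_neg_pi (r : ℝ) : rayPoint r (-Real.pi) = -r := by
  rw [← rayPoint_pi, ← rayPoint_periodic r (-Real.pi)]
  congr 1
  ring

theorem continuous_rayPoint : Continuous fun p : ℝ × ℝ => rayPoint p.1 p.2 := by
  unfold rayPoint
  fun_prop

theorem continuous_rayPoint_left (φ : ℝ) : Continuous fun r : ℝ => rayPoint r φ :=
  continuous_rayPoint.comp (Continuous.prodMk_left φ)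

theorem continuous_rayPoint_right (r : ℝ) : Continuous (rayPoint r) :=
  continuous_rayPoint.comp (Continuous.prodMk_right r)

theorem arg_rayPoint {r φ : ℝ} (hr : 0 < r) (hφ : φ ∈ Ioc (-Real.pi) Real.pi) :
    (rayPoint r φ).arg = φ := by
  rw [rayPoint, Complex.exp_mul_I]
  exact Complex.arg_mul_cos_add_sin_mul_I hr hφ

theorem abs_arg_lt_pi {z : ℂ} (hz : z ∈ Complex.slitPlane) : |z.arg| < Real.pi :=
  abs_lt.2 ⟨Complex.neg_pi_lt_arg z,
    (Complex.arg_le_pi z).lt_of_ne (Complex.mem_slitPlane_iff_arg.1 hz).1⟩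

theorem norm_rayPoint_add_sq (r t φ : ℝ) :
    ‖rayPoint r φ + t‖ ^ 2 = r ^ 2 + 2 * r * t * Real.cos φ + t ^ 2 := by
  have h : rayPoint r φ + t = ⟨r * Real.cos φ + t, r * Real.sin φ⟩ := by
    apply Complex.ext <;> simp [rayPoint, Complex.exp_ofReal_mul_I_re, Complex.exp_ofReal_mul_I_im]
  rw [h, ← Complex.normSq_eq_norm_sq, Complex.normSq_mk]
  linear_combination r ^ 2 * Real.sin_sq_add_cos_sq φ

theorem cos_half_mul_add_le_norm_rayPoint_add (r t φ : ℝ) :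
    Real.cos (φ / 2) * (r + t) ≤ ‖rayPoint r φ + t‖ := by
  refine le_of_sq_le_sq ?_ (norm_nonneg _)
  have hcos : Real.cos φ = 2 * Real.cos (φ / 2) ^ 2 - 1 := by
    rw [← Real.cos_two_mul, mul_div_cancel₀ φ two_ne_zero]
  rw [norm_rayPoint_add_sq, hcos]
  nlinarith [mul_nonneg (sub_nonneg.2 (Real.cos_sq_le_one (φ / 2))) (sq_nonneg (r - t))]

theorem cos_half_pos {φ : ℝ} (hφ : |φ| < Real.pi) : 0 < Real.cos (φ / 2) := by
  rw [abs_lt] at hφ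
  exact Real.cos_pos_of_mem_Ioo ⟨by linarith, by linarith⟩

theorem cos_half_le_cos_half {φ θ : ℝ} (hφ : |φ| ≤ θ) (hθ : θ ≤ Real.pi) :
    Real.cos (θ / 2) ≤ Real.cos (φ / 2) := by
  rw [← Real.cos_abs (φ / 2), abs_div, abs_two]
  exact Real.cos_le_cos_of_nonneg_of_le_pi (by positivity) (by linarith [Real.pi_pos])
    (by linarith)

end Polar

section Rectangle

variable {E : Type*} [NormedAddCommGroup E] {f g : ℂ → E} {a b c d : ℝ}

theorem intervalIntegrable_horizontal (hab : a ≤ b) {y : ℝ} {s : Set ℂ} (hf : ContinuousOn f s)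
    (hs : ∀ x ∈ Icc a b, (x + y * Complex.I : ℂ) ∈ s) :
    IntervalIntegrable (fun x : ℝ => f (x + y * Complex.I)) volume a b :=
  ContinuousOn.intervalIntegrable <| hf.comp (Continuous.continuousOn (by fun_prop))
    fun x hx => hs x (uIcc_of_le hab ▸ hx)

theorem intervalIntegrable_vertical (hcd : c ≤ d) {x : ℝ} {s : Set ℂ} (hf : ContinuousOn f s)
    (hs : ∀ y ∈ Icc c d, (x + y * Complex.I : ℂ) ∈ s) :
    IntervalIntegrable (fun y : ℝ => f (x + y * Complex.I)) volume c d :=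
  ContinuousOn.intervalIntegrable <| hf.comp (Continuous.continuousOn (by fun_prop))
    fun y hy => hs y (uIcc_of_le hcd ▸ hy)

theorem integrableOn_Ioi_of_norm_le_exp {F : ℝ → E} {q C : ℝ} (hq : 0 < q)
    (hF : ContinuousOn F (Ici a)) (hC : ∀ x ∈ Ici a, ‖F x‖ ≤ C * Real.exp (-q * x)) :
    IntegrableOn F (Ioi a) := by
  refine Integrable.mono' ((exp_neg_integrableOn_Ioi a hq).const_mul C)
    ((hF.mono Ioi_subset_Ici_self).aestronglyMeasurable measurableSet_Ioi) ?_
  exact (ae_restrict_mem measurableSet_Ioi).mono fun x hx => hC x (Ioi_subset_Ici_self hx)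

variable [NormedSpace ℂ E]

/-- The counterclockwise integral of `f` along the boundary of the rectangle
`[a, b] + [c, d] i`. -/
noncomputable def rectIntegral (f : ℂ → E) (a b c d : ℝ) : E :=
  (∫ x in a..b, f (x + c * Complex.I)) - (∫ x in a..b, f (x + d * Complex.I))
    + Complex.I • (∫ y in c..d, f (b + y * Complex.I))
    - Complex.I • ∫ y in c..d, f (a + y * Complex.I)

/-- The boundary of the rectangle `[a, b] + [c, d] i`. -/
def rectBoundary (a b c d : ℝ) : Set ℂ := (Icc a b ×ℂ Icc c d) \ (Ioo a b ×ℂ Ioo c d)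

theorem ofReal_add_mul_I_mem_reProdIm {s t : Set ℝ} {x y : ℝ} :
    (x + y * Complex.I : ℂ) ∈ s ×ℂ t ↔ x ∈ s ∧ y ∈ t := by
  simp [Complex.mem_reProdIm]

theorem horizontal_mem_rectBoundary (hcd : c ≤ d) {x : ℝ} (hx : x ∈ Icc a b) :
    (x + c * Complex.I : ℂ) ∈ rectBoundary a b c d ∧
      (x + d * Complex.I : ℂ) ∈ rectBoundary a b c d := by
  simp only [rectBoundary, mem_sdiff, ofReal_add_mul_I_mem_reProdIm]
  exact ⟨⟨⟨hx, left_mem_Icc.2 hcd⟩, fun h => lt_irrefl c h.2.1⟩,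
    ⟨hx, right_mem_Icc.2 hcd⟩, fun h => lt_irrefl d h.2.2⟩

theorem vertical_mem_rectBoundary (hab : a ≤ b) {y : ℝ} (hy : y ∈ Icc c d) :
    (a + y * Complex.I : ℂ) ∈ rectBoundary a b c d ∧
      (b + y * Complex.I : ℂ) ∈ rectBoundary a b c d := by
  simp only [rectBoundary, mem_sdiff, ofReal_add_mul_I_mem_reProdIm]
  exact ⟨⟨⟨left_mem_Icc.2 hab, hy⟩, fun h => lt_irrefl a h.1.1⟩,
    ⟨right_mem_Icc.2 hab, hy⟩, fun h => lt_irrefl b h.1.2⟩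

theorem rectIntegral_congr (hab : a ≤ b) (hcd : c ≤ d) (h : EqOn f g (rectBoundary a b c d)) :
    rectIntegral f a b c d = rectIntegral g a b c d := by
  have hx {x : ℝ} (hx : x ∈ uIcc a b) := horizontal_mem_rectBoundary hcd (uIcc_of_le hab ▸ hx)
  have hy {y : ℝ} (hy : y ∈ uIcc c d) := vertical_mem_rectBoundary hab (uIcc_of_le hcd ▸ hy)
  unfold rectIntegral
  congr 1
  · congr 1
    · exact congrArg₂ _ (intervalIntegral.integral_congr fun _ h' => h (hx h').1)
        (intervalIntegral.integral_congr fun _ h' => h (hx h').2)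
    · exact congrArg _ (intervalIntegral.integral_congr fun _ h' => h (hy h').2)
  · exact congrArg _ (intervalIntegral.integral_congr fun _ h' => h (hy h').1)

theorem rectIntegral_sub (hab : a ≤ b) (hcd : c ≤ d) (hf : ContinuousOn f (rectBoundary a b c d))
    (hg : ContinuousOn g (rectBoundary a b c d)) :
    rectIntegral (fun w => f w - g w) a b c d
      = rectIntegral f a b c d - rectIntegral g a b c d := by
  have hx (x : ℝ) (hx : x ∈ Icc a b) := horizontal_mem_rectBoundary hcd hx
  have hy (y : ℝ) (hy : y ∈ Icc c d) := vertical_mem_rectBoundary hab hy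
  have hbot {h : ℂ → E} (hh : ContinuousOn h (rectBoundary a b c d)) :=
    intervalIntegrable_horizontal hab hh fun x hx' => (hx x hx').1
  have htop {h : ℂ → E} (hh : ContinuousOn h (rectBoundary a b c d)) :=
    intervalIntegrable_horizontal hab hh fun x hx' => (hx x hx').2
  have hleft {h : ℂ → E} (hh : ContinuousOn h (rectBoundary a b c d)) :=
    intervalIntegrable_vertical hcd hh fun y hy' => (hy y hy').1
  have hright {h : ℂ → E} (hh : ContinuousOn h (rectBoundary a b c d)) :=
    intervalIntegrable_vertical hcd hh fun y hy' => (hy y hy').2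
  unfold rectIntegral
  rw [intervalIntegral.integral_sub (hbot hf) (hbot hg),
    intervalIntegral.integral_sub (htop hf) (htop hg),
    intervalIntegral.integral_sub (hleft hf) (hleft hg),
    intervalIntegral.integral_sub (hright hf) (hright hg)]
  module

theorem rectIntegral_smul_const [CompleteSpace E] (k : ℂ → ℂ) (v : E) :
    rectIntegral (fun w => k w • v) a b c d = rectIntegral k a b c d • v := by
  unfold rectIntegral
  simp only [intervalIntegral.integral_smul_const, sub_smul, add_smul, smul_assoc]

theorem rectIntegral_eq_zero (hab : a ≤ b) (hcd : c ≤ d) {s : Set ℂ} (hs : s.Countable)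
    (hf : ContinuousOn f (Icc a b ×ℂ Icc c d))
    (hd : ∀ w ∈ (Ioo a b ×ℂ Ioo c d) \ s, DifferentiableAt ℂ f w) :
    rectIntegral f a b c d = 0 :=
  Complex.integral_boundary_rect_eq_zero_of_differentiable_on_off_countable f ⟨a, c⟩ ⟨b, d⟩ s hs
    (by rwa [uIcc_of_le hab, uIcc_of_le hcd])
    (by rwa [min_eq_left hab, max_eq_right hab, min_eq_left hcd, max_eq_right hcd])

theorem tendsto_integral_zero_of_norm_le {ι : Type*} {l : Filter ι} {F : ι → ℝ → E} {u : ι → ℝ}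
    (hF : ∀ᶠ i in l, ∀ y ∈ uIcc c d, ‖F i y‖ ≤ u i) (hu : Filter.Tendsto u l (nhds 0)) :
    Filter.Tendsto (fun i => ∫ y in c..d, F i y) l (nhds 0) := by
  refine squeeze_zero_norm' (hF.mono fun i hi => ?_) (by simpa using hu.mul_const |d - c|)
  exact intervalIntegral.norm_integral_le_of_norm_le_const fun y hy => hi y (uIoc_subset_uIcc hy)

theorem integral_Ioi_sub_integral_Ioi_of_halfStrip {q C : ℝ} (hcd : c ≤ d) (hq : 0 < q)
    (hf : ContinuousOn f (Ici a ×ℂ Icc c d)) (hd : DifferentiableOn ℂ f (Ioi a ×ℂ Ioo c d))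
    (hC : ∀ w ∈ Ici a ×ℂ Icc c d, ‖f w‖ ≤ C * Real.exp (-q * w.re)) :
    (∫ x in Ioi a, f (x + c * Complex.I)) - (∫ x in Ioi a, f (x + d * Complex.I))
      = Complex.I • ∫ y in c..d, f (a + y * Complex.I) := by
  have hmem {x y : ℝ} (hx : x ∈ Ici a) (hy : y ∈ Icc c d) :
      (x + y * Complex.I : ℂ) ∈ Ici a ×ℂ Icc c d := ofReal_add_mul_I_mem_reProdIm.2 ⟨hx, hy⟩
  have hbound {x y : ℝ} (hx : x ∈ Ici a) (hy : y ∈ Icc c d) :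
      ‖f (x + y * Complex.I)‖ ≤ C * Real.exp (-q * x) := by
    simpa using hC _ (hmem hx hy)
  have hedge (y : ℝ) (hy : y ∈ Icc c d) : Filter.Tendsto (fun b : ℝ => ∫ x in a..b,
      f (x + y * Complex.I)) Filter.atTop (nhds (∫ x in Ioi a, f (x + y * Complex.I))) :=
    intervalIntegral_tendsto_integral_Ioi a (integrableOn_Ioi_of_norm_le_exp hq
      (hf.comp (Continuous.continuousOn (by fun_prop)) fun x hx => hmem hx hy)
      fun x hx => hbound hx hy) Filter.tendsto_id
  have hright : Filter.Tendsto (fun b : ℝ => ∫ y in c..d, f (b + y * Complex.I))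
      Filter.atTop (nhds 0) := by
    refine tendsto_integral_zero_of_norm_le (u := fun b => C * Real.exp (-q * b)) ?_ ?_
    · filter_upwards [Filter.eventually_ge_atTop a] with b hb y hy
      exact hbound hb (uIcc_of_le hcd ▸ hy)
    · have hexp := Real.tendsto_exp_atBot.comp
        (Filter.tendsto_id.const_mul_atTop_of_neg (neg_neg_of_pos hq))
      simpa using hexp.const_mul C
  have hzero : ∀ᶠ b in Filter.atTop, rectIntegral f a b c d = 0 := by
    filter_upwards [Filter.eventually_ge_atTop a] with b hb
    refine rectIntegral_eq_zero hb hcd countable_empty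
      (hf.mono fun w hw => ⟨hw.1.1, hw.2⟩) fun w hw => ?_
    exact hd.differentiableAt ((isOpen_Ioi.reProdIm isOpen_Ioo).mem_nhds ⟨hw.1.1.1, hw.1.2⟩)
  have hlim := (((hedge c (left_mem_Icc.2 hcd)).sub (hedge d (right_mem_Icc.2 hcd))).add
    (hright.const_smul Complex.I)).sub_const (Complex.I • ∫ y in c..d, f (a + y * Complex.I))
  have h := tendsto_nhds_unique (hlim.congr' hzero) tendsto_const_nhds
  rwa [smul_zero, add_zero, sub_eq_zero] at h

end Rectangle

section LogStrip

open scoped Real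

theorem exp_ne_of_mem_slitPlane {z w : ℂ} (hz : z ∈ Complex.slitPlane) (hw : |w.im| ≤ π)
    (hne : w ≠ Complex.log z) : Complex.exp w ≠ z := by
  rintro rfl
  rw [abs_le] at hw
  have him : -π < w.im := hw.1.lt_of_ne fun h => by
    rw [← Complex.re_add_im w, exp_ofReal_add_mul_I, ← h, rayPoint_neg_pi,
      Complex.neg_ofReal_mem_slitPlane] at hz
    exact (Real.exp_pos _).not_gt hz
  exact hne (Complex.log_exp him hw.2).symm

theorem dslope_exp_log_ne_zero {z w : ℂ} (hz : z ∈ Complex.slitPlane) (hw : |w.im| ≤ π) :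
    dslope Complex.exp (Complex.log z) w ≠ 0 := by
  rcases eq_or_ne w (Complex.log z) with rfl | hne
  · rw [dslope_same, Complex.deriv_exp]
    exact Complex.exp_ne_zero _
  · rw [dslope_of_ne _ hne, slope_def_field, Complex.exp_log (Complex.slitPlane_ne_zero hz)]
    exact div_ne_zero (sub_ne_zero.2 (exp_ne_of_mem_slitPlane hz hw hne)) (sub_ne_zero.2 hne)

/-- The kernel `e ^ w / (e ^ w - z)`: the pullback of `dζ / (ζ - z)` by `ζ = e ^ w`. -/
noncomputable def expKernel (z w : ℂ) : ℂ := Complex.exp w / (Complex.exp w - z)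

variable {z : ℂ} {a b : ℝ}

theorem continuousOn_expKernel (z : ℂ) : ContinuousOn (expKernel z) {w | Complex.exp w ≠ z} := by
  refine Complex.continuous_exp.continuousOn.div (by fun_prop) fun w hw => sub_ne_zero.2 hw

theorem expKernel_eq (z : ℂ) (x φ : ℝ) : expKernel z (x + φ * Complex.I)
    = rayPoint (Real.exp x) φ / (rayPoint (Real.exp x) φ - z) := by
  rw [expKernel, exp_ofReal_add_mul_I]

theorem expKernel_add_pi (z : ℂ) (x : ℝ) :
    expKernel z (x + π * Complex.I) = Real.exp x * (z + Real.exp x)⁻¹ := by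
  rw [expKernel_eq, rayPoint_pi, ← neg_add', neg_div_neg_eq, add_comm, div_eq_mul_inv]

theorem expKernel_sub_pi (z : ℂ) (x : ℝ) :
    expKernel z (x + (-π : ℝ) * Complex.I) = Real.exp x * (z + Real.exp x)⁻¹ := by
  rw [expKernel_eq, rayPoint_neg_pi, ← neg_add', neg_div_neg_eq, add_comm, div_eq_mul_inv]

theorem norm_expKernel_le {x : ℝ} (hx : Real.exp x ≠ ‖z‖) (φ : ℝ) :
    ‖expKernel z (x + φ * Complex.I)‖ ≤ Real.exp x / |Real.exp x - ‖z‖| := by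
  rw [expKernel_eq, norm_div, norm_rayPoint (Real.exp_pos x).le]
  have hsub := abs_norm_sub_norm_le (rayPoint (Real.exp x) φ) z
  rw [norm_rayPoint (Real.exp_pos x).le] at hsub
  exact div_le_div_of_nonneg_left (Real.exp_pos x).le (abs_pos.2 (sub_ne_zero.2 hx)) hsub

theorem integral_arc_eq_circleIntegral {E : Type*} [NormedAddCommGroup E] [NormedSpace ℂ E]
    (r c : ℝ) (F : ℂ → E) : ∫ φ in c..c + 2 * π, (Complex.I * rayPoint r φ) • F (rayPoint r φ)
      = ∮ z in C(0, r), F z := by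
  have hper : Function.Periodic (fun φ : ℝ => (Complex.I * rayPoint r φ) • F (rayPoint r φ))
      (2 * π) := fun φ => by simp only [rayPoint_periodic r φ]
  rw [hper.intervalIntegral_add_eq c 0, zero_add, circleIntegral]
  simp only [deriv_circleMap, circleMap_zero_eq_rayPoint, mul_comm]

theorem I_smul_integral_expKernel (z : ℂ) (x : ℝ) :
    Complex.I • ∫ φ in -π..π, expKernel z (x + φ * Complex.I)
      = ∮ ζ in C(0, Real.exp x), (ζ - z)⁻¹ := by
  rw [← integral_arc_eq_circleIntegral _ (-π), neg_add_eq_sub, two_mul, add_sub_cancel_right,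
    ← intervalIntegral.integral_smul]
  simp only [expKernel_eq, smul_eq_mul, div_eq_mul_inv, mul_assoc]

theorem circleIntegral_sub_inv_eq_zero {r : ℝ} (hr : 0 ≤ r) (hz : r < ‖z‖) :
    ∮ ζ in C(0, r), (ζ - z)⁻¹ = 0 := by
  refine DiffContOnCl.circleIntegral_eq_zero hr (DifferentiableOn.diffContOnCl_ball
    (U := Metric.closedBall 0 r) (fun ζ hζ => ?_) subset_rfl)
  have hne : ζ - z ≠ 0 := sub_ne_zero.2 fun h => (mem_closedBall_zero_iff.1 hζ).not_gt (h ▸ hz)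
  exact ((differentiableAt_id.sub_const z).inv hne).differentiableWithinAt

theorem rectIntegral_expKernel (ha : Real.exp a < ‖z‖) (hb : ‖z‖ < Real.exp b) :
    rectIntegral (expKernel z) a b (-π) π = 2 * π * Complex.I := by
  unfold rectIntegral
  rw [I_smul_integral_expKernel, I_smul_integral_expKernel,
    circleIntegral.integral_sub_inv_of_mem_ball (mem_ball_zero_iff.2 hb),
    circleIntegral_sub_inv_eq_zero (Real.exp_pos a).le ha, sub_zero]
  simp only [expKernel_add_pi, expKernel_sub_pi, sub_self, zero_add]

variable {E : Type*} [NormedAddCommGroup E] [NormedSpace ℂ E] {f : ℂ → E}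

theorem exp_smul_inv_dslope_exp_smul_dslope {w w₀ : ℂ} (hne : w ≠ w₀) :
    (Complex.exp w * (dslope Complex.exp w₀ w)⁻¹) • dslope f w₀ w
      = expKernel (Complex.exp w₀) w • (f w - f w₀) := by
  rw [dslope_of_ne _ hne, dslope_of_ne _ hne, slope_def_field, slope_def_module, smul_smul,
    expKernel, inv_div, mul_assoc, div_mul_eq_mul_div, mul_inv_cancel₀ (sub_ne_zero.2 hne),
    mul_one_div]

theorem log_mem_reProdIm (hz : z ∈ Complex.slitPlane) (ha : Real.exp a < ‖z‖)
    (hb : ‖z‖ < Real.exp b) : Complex.log z ∈ Ioo a b ×ℂ Ioo (-π) π := by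
  have hz0 := norm_pos_iff.2 (Complex.slitPlane_ne_zero hz)
  rw [Complex.mem_reProdIm, Complex.log_re, Complex.log_im]
  exact ⟨⟨(Real.lt_log_iff_exp_lt hz0).2 ha, (Real.log_lt_iff_lt_exp hz0).2 hb⟩,
    abs_lt.1 (abs_arg_lt_pi hz)⟩

/-- The difference quotients of `f` and of `exp` at `log z` turn the simple pole of the kernel into
a removable singularity. -/
theorem rectIntegral_expKernel_smul_sub (hz : z ∈ Complex.slitPlane) (ha : Real.exp a < ‖z‖)
    (hb : ‖z‖ < Real.exp b) (hf : ContinuousOn f (Icc a b ×ℂ Icc (-π) π))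
    (hd : DifferentiableOn ℂ f (Ioo a b ×ℂ Ioo (-π) π)) :
    rectIntegral (fun w => expKernel z w • (f w - f (Complex.log z))) a b (-π) π = 0 := by
  have hab : a ≤ b := (Real.exp_lt_exp.1 (ha.trans hb)).le
  have hpi : -π ≤ π := by linarith [Real.pi_pos]
  set w₀ := Complex.log z
  have hexp : Complex.exp w₀ = z := Complex.exp_log (Complex.slitPlane_ne_zero hz)
  have hmem : w₀ ∈ Ioo a b ×ℂ Ioo (-π) π := log_mem_reProdIm hz ha hb
  have hnhds := (isOpen_Ioo.reProdIm isOpen_Ioo).mem_nhds hmem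
  have hsub : Ioo a b ×ℂ Ioo (-π) π ⊆ Icc a b ×ℂ Icc (-π) π :=
    Complex.reProdIm_subset_iff.2 (prod_mono Ioo_subset_Icc_self Ioo_subset_Icc_self)
  have hslope {w : ℂ} (hw : w ∈ Icc a b ×ℂ Icc (-π) π) : dslope Complex.exp w₀ w ≠ 0 :=
    dslope_exp_log_ne_zero hz (abs_le.2 hw.2)
  have hboundary : EqOn (fun w => expKernel z w • (f w - f w₀))
      (fun w => (Complex.exp w * (dslope Complex.exp w₀ w)⁻¹) • dslope f w₀ w)
      (rectBoundary a b (-π) π) := fun w hw => by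
    beta_reduce
    rw [exp_smul_inv_dslope_exp_smul_dslope (ne_of_mem_of_not_mem hmem hw.2).symm, hexp]
  rw [rectIntegral_congr hab hpi hboundary]
  refine rectIntegral_eq_zero hab hpi (countable_singleton w₀) ?_ fun w hw => ?_
  · have hcexp : ContinuousOn (dslope Complex.exp w₀) univ := (continuousOn_dslope
      Filter.univ_mem).2 ⟨Complex.continuous_exp.continuousOn, Complex.differentiableAt_exp⟩
    have hcf : ContinuousOn (dslope f w₀) (Icc a b ×ℂ Icc (-π) π) :=
      (continuousOn_dslope (Filter.mem_of_superset hnhds hsub)).2 ⟨hf, hd.differentiableAt hnhds⟩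
    exact (Complex.continuous_exp.continuousOn.mul
      ((hcexp.mono (subset_univ _)).inv₀ fun w => hslope)).smul hcf
  · have hdexp := (differentiableAt_dslope_of_ne hw.2).2 (Complex.differentiableAt_exp (x := w))
    have hdf := (differentiableAt_dslope_of_ne hw.2).2
      (hd.differentiableAt ((isOpen_Ioo.reProdIm isOpen_Ioo).mem_nhds hw.1))
    exact (Complex.differentiableAt_exp.mul (hdexp.inv (hslope (hsub hw.1)))).smul hdf

theorem rectIntegral_expKernel_smul [CompleteSpace E] (hz : z ∈ Complex.slitPlane)
    (ha : Real.exp a < ‖z‖) (hb : ‖z‖ < Real.exp b) (hf : ContinuousOn f (Icc a b ×ℂ Icc (-π) π))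
    (hd : DifferentiableOn ℂ f (Ioo a b ×ℂ Ioo (-π) π)) :
    rectIntegral (fun w => expKernel z w • f w) a b (-π) π
      = (2 * π * Complex.I) • f (Complex.log z) := by
  have hab : a ≤ b := (Real.exp_lt_exp.1 (ha.trans hb)).le
  have hpi : -π ≤ π := by linarith [Real.pi_pos]
  have hK : ContinuousOn (expKernel z) (rectBoundary a b (-π) π) :=
    (continuousOn_expKernel z).mono fun w hw => exp_ne_of_mem_slitPlane hz (abs_le.2 hw.1.2)
      (ne_of_mem_of_not_mem (log_mem_reProdIm hz ha hb) hw.2).symm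
  have h := rectIntegral_expKernel_smul_sub hz ha hb hf hd
  simp only [smul_sub] at h
  rw [rectIntegral_sub (f := fun w => expKernel z w • f w)
    (g := fun w => expKernel z w • f (Complex.log z)) hab hpi
    (hK.smul (hf.mono sdiff_subset)) (hK.smul continuousOn_const), rectIntegral_smul_const,
    rectIntegral_expKernel ha hb, sub_eq_zero] at h
  exact h

end LogStrip

section Inversion

open scoped Real

variable {E : Type*} [NormedAddCommGroup E]

theorem cos_half_arg_mul_add_le_norm_add (z : ℂ) (t : ℝ) :
    Real.cos (z.arg / 2) * (‖z‖ + t) ≤ ‖z + t‖ := by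
  simpa only [rayPoint_norm_arg] using cos_half_mul_add_le_norm_rayPoint_add ‖z‖ t z.arg

theorem norm_inv_add_ofReal_le {z : ℂ} (hz : z ∈ Complex.slitPlane) {ρ : ℝ} (hρ : 0 ≤ ρ) :
    ‖(z + ρ)⁻¹‖ ≤ (Real.cos (z.arg / 2) * min ‖z‖ 1)⁻¹ * (1 + ρ)⁻¹ := by
  have hcos := cos_half_pos (abs_arg_lt_pi hz)
  have hmin : 0 < min ‖z‖ 1 := lt_min (norm_pos_iff.2 (Complex.slitPlane_ne_zero hz)) one_pos
  rw [norm_inv, ← mul_inv]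
  refine inv_anti₀ (by positivity) (le_trans ?_ (cos_half_arg_mul_add_le_norm_add z ρ))
  rw [mul_assoc, mul_add, mul_one]
  gcongr
  exacts [min_le_left _ _, mul_le_of_le_one_left hρ (min_le_right _ _)]

theorem add_ofReal_ne_zero {z : ℂ} (hz : z ∈ Complex.slitPlane) {ρ : ℝ} (hρ : 0 ≤ ρ) :
    z + ρ ≠ 0 := by
  have hcos := cos_half_pos (abs_arg_lt_pi hz)
  have hnorm := norm_pos_iff.2 (Complex.slitPlane_ne_zero hz)
  exact norm_pos_iff.1 (lt_of_lt_of_le (by positivity) (cos_half_arg_mul_add_le_norm_add z ρ))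

theorem continuousOn_inv_add_ofReal {z : ℂ} (hz : z ∈ Complex.slitPlane) :
    ContinuousOn (fun ρ : ℝ => (z + ρ)⁻¹) (Ici 0) :=
  ContinuousOn.inv₀ (by fun_prop) fun _ hρ => add_ofReal_ne_zero hz hρ

theorem integrableOn_rpow_neg_mul_inv_one_add {α : ℝ} (hα : 0 < α) (hα1 : α < 1) :
    IntegrableOn (fun ρ : ℝ => ρ ^ (-α) * (1 + ρ)⁻¹) (Ioi 0) := by
  have hcont : ContinuousOn (fun ρ : ℝ => (1 + ρ)⁻¹) (Ioi 0) :=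
    ContinuousOn.inv₀ (by fun_prop) fun ρ hρ => (add_pos one_pos hρ).ne'
  have htop : (fun ρ : ℝ => (1 + ρ)⁻¹) =O[Filter.atTop] (· ^ (-(1 : ℝ))) := by
    refine Asymptotics.IsBigO.of_bound 1 ?_
    filter_upwards [Filter.eventually_gt_atTop 0] with ρ hρ
    rw [Real.rpow_neg_one, one_mul, Real.norm_of_nonneg (by positivity),
      Real.norm_of_nonneg (by positivity)]
    exact inv_anti₀ hρ (by linarith)
  have hbot : (fun ρ : ℝ => (1 + ρ)⁻¹) =O[nhdsWithin 0 (Ioi 0)] (· ^ (-(0 : ℝ))) := by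
    refine Asymptotics.IsBigO.of_bound 1 (eventually_mem_nhdsWithin.mono fun ρ hρ => ?_)
    have hρ : 0 < ρ := hρ
    rw [neg_zero, Real.rpow_zero, norm_one, one_mul, Real.norm_of_nonneg (by positivity)]
    exact inv_le_one_of_one_le₀ (by linarith)
  have h := mellin_convergent_of_isBigO_scalar (s := 1 - α)
    (hcont.locallyIntegrableOn measurableSet_Ioi) htop (by linarith) hbot (by linarith)
  simpa only [sub_sub_cancel_left] using h

theorem integrableOn_Ioi_of_norm_le_rpow {α C : ℝ} (hα : 0 < α) (hα1 : α < 1) {F : ℝ → E}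
    (hF : ContinuousOn F (Ioi 0)) (hC : ∀ ρ, 0 < ρ → ‖F ρ‖ ≤ C * (ρ ^ (-α) * (1 + ρ)⁻¹)) :
    IntegrableOn F (Ioi 0) :=
  Integrable.mono' ((integrableOn_rpow_neg_mul_inv_one_add hα hα1).const_mul C)
    (hF.aestronglyMeasurable measurableSet_Ioi)
    ((ae_restrict_mem measurableSet_Ioi).mono fun ρ hρ => hC ρ hρ)

theorem integrable_comp_exp_iff [NormedSpace ℝ E] (g : ℝ → E) :
    Integrable (fun x => Real.exp x • g (Real.exp x)) ↔ IntegrableOn g (Ioi 0) := by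
  rw [← Real.range_exp, ← image_univ, integrableOn_image_iff_integrableOn_abs_deriv_smul
    MeasurableSet.univ (fun x _ => (Real.hasDerivAt_exp x).hasDerivWithinAt)
    Real.exp_injective.injOn]
  simp only [Real.abs_exp, integrableOn_univ]

theorem integral_comp_exp [NormedSpace ℝ E] (g : ℝ → E) :
    ∫ x, Real.exp x • g (Real.exp x) = ∫ ρ in Ioi 0, g ρ := by
  rw [← Real.range_exp, ← image_univ, integral_image_eq_integral_abs_deriv_smul
    MeasurableSet.univ (fun x _ => (Real.hasDerivAt_exp x).hasDerivWithinAt)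
    Real.exp_injective.injOn]
  simp only [Real.abs_exp, setIntegral_univ]

theorem tendsto_exp_mul_div_abs_exp_sub_atTop {α : ℝ} (hα : 0 < α) (r : ℝ) :
    Filter.Tendsto (fun x => Real.exp x / |Real.exp x - r| * Real.exp (-α * x)) Filter.atTop
      (nhds 0) := by
  have hneg (c : ℝ) (hc : 0 < c) : Filter.Tendsto (fun x => Real.exp (-c * x)) Filter.atTop
      (nhds 0) := Real.tendsto_exp_atBot.comp
        (Filter.tendsto_id.const_mul_atTop_of_neg (neg_neg_of_pos hc))
  have hden : Filter.Tendsto (fun x => |1 - r * Real.exp (-1 * x)|⁻¹) Filter.atTop (nhds 1) := by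
    simpa using (((hneg 1 one_pos).const_mul r).const_sub 1).abs.inv₀ (by simp)
  have hlim := hden.mul (hneg α hα)
  rw [mul_zero] at hlim
  refine hlim.congr fun x => ?_
  have hsplit : Real.exp x - r = Real.exp x * (1 - r * Real.exp (-1 * x)) := by
    rw [mul_sub, mul_left_comm, ← Real.exp_add]
    simp
  rw [hsplit, abs_mul, Real.abs_exp, div_mul_cancel_left₀ (Real.exp_ne_zero x)]

theorem tendsto_exp_mul_div_abs_exp_sub_atBot {α r : ℝ} (hα1 : α < 1) (hr : 0 < r) :
    Filter.Tendsto (fun x => Real.exp x / |Real.exp x - r| * Real.exp (-α * x)) Filter.atBot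
      (nhds 0) := by
  have hnum : Filter.Tendsto (fun x => Real.exp ((1 - α) * x)) Filter.atBot (nhds 0) :=
    Real.tendsto_exp_atBot.comp (Filter.tendsto_id.const_mul_atBot (sub_pos.2 hα1))
  have hlim := hnum.div (Real.tendsto_exp_atBot.sub_const r).abs (by simpa using hr.ne')
  rw [zero_div] at hlim
  refine hlim.congr fun x => ?_
  rw [div_mul_eq_mul_div, ← Real.exp_add, Pi.div_apply]
  ring_nf

variable [NormedSpace ℂ E] {α C : ℝ} {z : ℂ} {f : ℂ → E}

theorem tendsto_integral_expKernel_smul {l : Filter ℝ}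
    (hC : ∀ w ∈ univ ×ℂ Icc (-π) π, ‖f w‖ ≤ C * Real.exp (-α * w.re))
    (hne : ∀ᶠ x in l, Real.exp x ≠ ‖z‖)
    (hl : Filter.Tendsto (fun x => Real.exp x / |Real.exp x - ‖z‖| * Real.exp (-α * x)) l
      (nhds 0)) :
    Filter.Tendsto (fun x : ℝ => ∫ φ in -π..π, expKernel z (x + φ * Complex.I) •
      f (x + φ * Complex.I)) l (nhds 0) := by
  refine tendsto_integral_zero_of_norm_le (hne.mono fun x hx φ hφ => ?_)
    (by simpa only [mul_zero] using hl.const_mul C)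
  rw [uIcc_of_le (by linarith [Real.pi_pos])] at hφ
  have hf := hC _ (ofReal_add_mul_I_mem_reProdIm.2 ⟨mem_univ x, hφ⟩)
  have hre : (x + φ * Complex.I : ℂ).re = x := by simp
  rw [hre] at hf
  calc ‖expKernel z (x + φ * Complex.I) • f (x + φ * Complex.I)‖
      ≤ Real.exp x / |Real.exp x - ‖z‖| * (C * Real.exp (-α * x)) := by
        rw [norm_smul]
        exact mul_le_mul (norm_expKernel_le hx φ) hf (norm_nonneg _) (by positivity)
    _ = C * (Real.exp x / |Real.exp x - ‖z‖| * Real.exp (-α * x)) := mul_left_comm _ _ _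

theorem integrableOn_inv_add_smul_comp_log (hα : 0 < α) (hα1 : α < 1)
    (hz : z ∈ Complex.slitPlane) (hf : ContinuousOn f (univ ×ℂ Icc (-π) π))
    (hC : ∀ w ∈ univ ×ℂ Icc (-π) π, ‖f w‖ ≤ C * Real.exp (-α * w.re)) {φ : ℝ}
    (hφ : φ ∈ Icc (-π) π) :
    IntegrableOn (fun ρ : ℝ => (z + ρ)⁻¹ • f (Real.log ρ + φ * Complex.I)) (Ioi 0) := by
  have hmem (x : ℝ) : (x + φ * Complex.I : ℂ) ∈ univ ×ℂ Icc (-π) π :=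
    ofReal_add_mul_I_mem_reProdIm.2 ⟨mem_univ x, hφ⟩
  have hlog : ContinuousOn (fun ρ : ℝ => (Real.log ρ + φ * Complex.I : ℂ)) (Ioi 0) :=
    (Complex.continuous_ofReal.comp_continuousOn
      (Real.continuousOn_log.mono fun ρ hρ => hρ.ne')).add continuousOn_const
  refine integrableOn_Ioi_of_norm_le_rpow hα hα1
    (C := (Real.cos (z.arg / 2) * min ‖z‖ 1)⁻¹ * C)
    (((continuousOn_inv_add_ofReal hz).mono Ioi_subset_Ici_self).smul
      (hf.comp hlog fun ρ _ => hmem _)) fun ρ hρ => ?_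
  have hfρ : ‖f (Real.log ρ + φ * Complex.I)‖ ≤ C * ρ ^ (-α) := by
    simpa [Real.rpow_def_of_pos hρ, mul_comm] using hC _ (hmem (Real.log ρ))
  have hinv := norm_inv_add_ofReal_le hz hρ.le
  calc ‖(z + ρ)⁻¹ • f (Real.log ρ + φ * Complex.I)‖
      ≤ ((Real.cos (z.arg / 2) * min ‖z‖ 1)⁻¹ * (1 + ρ)⁻¹) * (C * ρ ^ (-α)) := by
        rw [norm_smul]
        exact mul_le_mul hinv hfρ (norm_nonneg _) ((norm_nonneg _).trans hinv)
    _ = _ := by ring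

theorem tendsto_integral_edge (hα : 0 < α) (hα1 : α < 1)
    (hz : z ∈ Complex.slitPlane) (hf : ContinuousOn f (univ ×ℂ Icc (-π) π))
    (hC : ∀ w ∈ univ ×ℂ Icc (-π) π, ‖f w‖ ≤ C * Real.exp (-α * w.re)) {φ : ℝ}
    (hφ : φ ∈ Icc (-π) π)
    (hK : ∀ x : ℝ, expKernel z (x + φ * Complex.I) = Real.exp x * (z + Real.exp x)⁻¹) :
    Filter.Tendsto (fun n : ℝ => ∫ x in -n..n,
      expKernel z (x + φ * Complex.I) • f (x + φ * Complex.I)) Filter.atTop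
      (nhds (∫ ρ in Ioi (0 : ℝ), (z + ρ)⁻¹ • f (Real.log ρ + φ * Complex.I))) := by
  have hint := (integrable_comp_exp_iff _).2
    (integrableOn_inv_add_smul_comp_log hα hα1 hz hf hC hφ)
  rw [← integral_comp_exp]
  refine (intervalIntegral_tendsto_integral hint
    Filter.tendsto_neg_atTop_atBot Filter.tendsto_id).congr fun n => ?_
  simp only [hK, Real.log_exp, mul_smul, Complex.coe_smul, id]

/-- Cauchy's formula on the slit plane, in the coordinate `w = log ζ`: the two sides of the cut are
the lines `im w = ± π`. -/
theorem integral_inv_add_smul_sub_comp_log [CompleteSpace E] (hα : 0 < α) (hα1 : α < 1)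
    (hz : z ∈ Complex.slitPlane) (hf : ContinuousOn f (univ ×ℂ Icc (-π) π))
    (hd : DifferentiableOn ℂ f (univ ×ℂ Ioo (-π) π))
    (hC : ∀ w ∈ univ ×ℂ Icc (-π) π, ‖f w‖ ≤ C * Real.exp (-α * w.re)) :
    ∫ ρ in Ioi (0 : ℝ), (z + ρ)⁻¹ •
      (f (Real.log ρ + (-π : ℝ) * Complex.I) - f (Real.log ρ + π * Complex.I))
      = (2 * π * Complex.I) • f (Complex.log z) := by
  have hbot : -π ∈ Icc (-π) π := left_mem_Icc.2 (by linarith [Real.pi_pos])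
  have htop : π ∈ Icc (-π) π := right_mem_Icc.2 (by linarith [Real.pi_pos])
  have hz0 := norm_pos_iff.2 (Complex.slitPlane_ne_zero hz)
  have hright := tendsto_integral_expKernel_smul hC
    ((Real.tendsto_exp_atTop.eventually_gt_atTop ‖z‖).mono fun x => ne_of_gt)
    (tendsto_exp_mul_div_abs_exp_sub_atTop hα ‖z‖)
  have hleft := (tendsto_integral_expKernel_smul hC
    ((Real.tendsto_exp_atBot.eventually_lt_const hz0).mono fun x => ne_of_lt)
    (tendsto_exp_mul_div_abs_exp_sub_atBot hα1 hz0)).comp Filter.tendsto_neg_atTop_atBot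
  have hlim := (((tendsto_integral_edge hα hα1 hz hf hC hbot (expKernel_sub_pi z)).sub
    (tendsto_integral_edge hα hα1 hz hf hC htop (expKernel_add_pi z))).add
    (hright.const_smul Complex.I)).sub (hleft.const_smul Complex.I)
  have hres : ∀ᶠ n : ℝ in Filter.atTop, rectIntegral (fun w => expKernel z w • f w) (-n) n (-π) π
      = (2 * π * Complex.I) • f (Complex.log z) := by
    filter_upwards [Real.tendsto_exp_atTop.eventually_gt_atTop ‖z‖,
      (Real.tendsto_exp_atBot.comp Filter.tendsto_neg_atTop_atBot).eventually_lt_const hz0]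
      with n hn hn'
    exact rectIntegral_expKernel_smul hz hn' hn (hf.mono fun w hw => ⟨mem_univ _, hw.2⟩)
      (hd.mono fun w hw => ⟨mem_univ _, hw.2⟩)
  have h := tendsto_nhds_unique (hlim.congr' hres) tendsto_const_nhds
  rw [smul_zero, sub_zero, add_zero,
    ← integral_sub (integrableOn_inv_add_smul_comp_log hα hα1 hz hf hC hbot)
      (integrableOn_inv_add_smul_comp_log hα hα1 hz hf hC htop)] at h
  simpa only [← smul_sub] using h

end Inversion

section FracKernel

open scoped Real ComplexConjugate

variable {α t : ℝ}

/-- The function `(z ^ α + t)⁻¹` in the coordinate `w = log z`. -/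
noncomputable def invPowAdd (α t : ℝ) (w : ℂ) : ℂ := (Complex.exp (α * w) + t)⁻¹

/-- The density of the Stieltjes representation of `(z ^ α + t)⁻¹`, without its factor
`sin (π α) / π`. -/
noncomputable def fracKernel (α t ρ : ℝ) : ℝ :=
  ρ ^ α / (ρ ^ (2 * α) + 2 * t * Real.cos (π * α) * ρ ^ α + t ^ 2)

theorem fracKernel_zero_right {ρ : ℝ} (hρ : 0 < ρ) : fracKernel α 0 ρ = ρ ^ (-α) := by
  have hpow : ρ ^ α ≠ 0 := (Real.rpow_pos_of_pos hρ α).ne'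
  rw [fracKernel, two_mul α, Real.rpow_add hρ, Real.rpow_neg hρ.le]
  field_simp [hpow]
  ring

theorem fracKernel_eq {ρ : ℝ} (hρ : 0 ≤ ρ) :
    fracKernel α t ρ = ρ ^ α / ‖rayPoint (ρ ^ α) (α * π) + t‖ ^ 2 := by
  rw [norm_rayPoint_add_sq, fracKernel, mul_comm 2 α, Real.rpow_mul hρ, Real.rpow_two, mul_comm π]
  ring

theorem fracKernel_nonneg {ρ : ℝ} (hρ : 0 ≤ ρ) : 0 ≤ fracKernel α t ρ := by
  rw [fracKernel_eq hρ]
  positivity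

theorem cos_half_pi_mul_pos (hα : 0 < α) (hα1 : α < 1) : 0 < Real.cos (α * π / 2) :=
  cos_half_pos (by rw [abs_of_pos (by positivity)]; exact mul_lt_of_lt_one_left Real.pi_pos hα1)

theorem cos_half_mul_le_norm_rayPoint_add (hα : 0 < α) (hα1 : α < 1) (ht : 0 ≤ t) {r φ : ℝ}
    (hr : 0 ≤ r) (hφ : |φ| ≤ π) :
    Real.cos (α * π / 2) * r ≤ ‖rayPoint r (α * φ) + t‖ := by
  have hcos : Real.cos (α * π / 2) ≤ Real.cos (α * φ / 2) := by
    refine cos_half_le_cos_half ?_ (mul_le_of_le_one_left Real.pi_pos.le hα1.le)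
    rw [abs_mul, abs_of_pos hα]
    gcongr
  have hpos := cos_half_pi_mul_pos hα hα1
  refine (mul_le_mul hcos (le_add_of_nonneg_right ht) hr (hpos.le.trans hcos)).trans ?_
  exact cos_half_mul_add_le_norm_rayPoint_add r t (α * φ)

theorem exp_mul_eq_rayPoint (α : ℝ) (w : ℂ) :
    Complex.exp (α * w) = rayPoint (Real.exp (α * w.re)) (α * w.im) := by
  rw [← exp_ofReal_add_mul_I]
  push_cast
  rw [mul_assoc, ← mul_add, Complex.re_add_im]

theorem exp_mul_log_add_mul_I {ρ : ℝ} (hρ : 0 < ρ) (φ : ℝ) :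
    Complex.exp (α * (Real.log ρ + φ * Complex.I)) = rayPoint (ρ ^ α) (α * φ) := by
  simp [exp_mul_eq_rayPoint, Real.rpow_def_of_pos hρ, mul_comm]

theorem cos_half_mul_exp_le_norm_exp_mul_add (hα : 0 < α) (hα1 : α < 1) (ht : 0 ≤ t) {w : ℂ}
    (hw : |w.im| ≤ π) :
    Real.cos (α * π / 2) * Real.exp (α * w.re) ≤ ‖Complex.exp (α * w) + t‖ := by
  rw [exp_mul_eq_rayPoint]
  exact cos_half_mul_le_norm_rayPoint_add hα hα1 ht (Real.exp_pos _).le hw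

theorem exp_mul_add_ne_zero (hα : 0 < α) (hα1 : α < 1) (ht : 0 ≤ t) {w : ℂ} (hw : |w.im| ≤ π) :
    Complex.exp (α * w) + t ≠ 0 :=
  norm_pos_iff.1 <| (mul_pos (cos_half_pi_mul_pos hα hα1) (Real.exp_pos _)).trans_le
    (cos_half_mul_exp_le_norm_exp_mul_add hα hα1 ht hw)

theorem norm_invPowAdd_le (hα : 0 < α) (hα1 : α < 1) (ht : 0 ≤ t) {w : ℂ} (hw : |w.im| ≤ π) :
    ‖invPowAdd α t w‖ ≤ (Real.cos (α * π / 2))⁻¹ * Real.exp (-α * w.re) := by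
  rw [invPowAdd, norm_inv, neg_mul, Real.exp_neg, ← mul_inv]
  exact inv_anti₀ (mul_pos (cos_half_pi_mul_pos hα hα1) (Real.exp_pos _))
    (cos_half_mul_exp_le_norm_exp_mul_add hα hα1 ht hw)

theorem differentiableAt_invPowAdd (hα : 0 < α) (hα1 : α < 1) (ht : 0 ≤ t) {w : ℂ}
    (hw : |w.im| ≤ π) : DifferentiableAt ℂ (invPowAdd α t) w := by
  have hexp : DifferentiableAt ℂ (fun w : ℂ => Complex.exp (α * w) + t) w := by fun_prop
  exact hexp.inv (exp_mul_add_ne_zero hα hα1 ht hw)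

theorem invPowAdd_conj (α t : ℝ) (w : ℂ) : invPowAdd α t (conj w) = conj (invPowAdd α t w) := by
  simp only [invPowAdd, map_inv₀, map_add, ← Complex.exp_conj, map_mul, Complex.conj_ofReal]

theorem invPowAdd_log (α t : ℝ) {z : ℂ} (hz : z ≠ 0) :
    invPowAdd α t (Complex.log z) = (z ^ (α : ℂ) + t)⁻¹ := by
  rw [invPowAdd, Complex.cpow_def_of_ne_zero hz, mul_comm]

/-- The values on the two sides of the cut are conjugate, so their difference is an imaginary
part. -/
theorem invPowAdd_neg_pi_sub_pi {ρ : ℝ} (hρ : 0 < ρ) :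
    invPowAdd α t (Real.log ρ + (-π : ℝ) * Complex.I) - invPowAdd α t (Real.log ρ + π * Complex.I)
      = 2 * Complex.I * Real.sin (π * α) * fracKernel α t ρ := by
  have hconj : (Real.log ρ + (-π : ℝ) * Complex.I : ℂ) = conj (Real.log ρ + π * Complex.I) := by
    simp
  have him : (invPowAdd α t (Real.log ρ + π * Complex.I)).im
      = -(Real.sin (π * α) * fracKernel α t ρ) := by
    rw [invPowAdd, exp_mul_log_add_mul_I hρ, Complex.inv_im, Complex.normSq_eq_norm_sq,
      fracKernel_eq hρ.le, rayPoint, Complex.add_im, Complex.im_ofReal_mul, Complex.ofReal_im,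
      add_zero, Complex.exp_ofReal_mul_I_im, mul_comm π]
    ring
  rw [hconj, invPowAdd_conj, ← neg_sub, Complex.sub_conj, him]
  push_cast
  ring

theorem fracKernel_le (hα : 0 < α) (hα1 : α < 1) (ht : 0 ≤ t) {ρ : ℝ} (hρ : 0 < ρ) :
    fracKernel α t ρ ≤ (Real.cos (α * π / 2) ^ 2)⁻¹ * ρ ^ (-α) := by
  have hcos := cos_half_pi_mul_pos hα hα1
  have hpow := Real.rpow_pos_of_pos hρ α
  have hnorm := cos_half_mul_le_norm_rayPoint_add hα hα1 ht hpow.le (abs_of_pos Real.pi_pos).le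
  rw [fracKernel_eq hρ.le, Real.rpow_neg hρ.le]
  calc ρ ^ α / ‖rayPoint (ρ ^ α) (α * π) + t‖ ^ 2
      ≤ ρ ^ α / (Real.cos (α * π / 2) * ρ ^ α) ^ 2 := by gcongr
    _ = _ := by field_simp

theorem continuousOn_fracKernel (hα : 0 < α) (hα1 : α < 1) (ht : 0 ≤ t) :
    ContinuousOn (fracKernel α t) (Ioi 0) := by
  have hpow : ContinuousOn (fun ρ : ℝ => ρ ^ α) (Ioi 0) :=
    (Real.continuous_rpow_const hα.le).continuousOn
  refine ContinuousOn.congr ?_ fun ρ hρ => fracKernel_eq (Ioi_subset_Ici_self hρ)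
  refine hpow.div ((((continuous_rayPoint_left _).comp_continuousOn hpow).add
    continuousOn_const).norm.pow 2) fun ρ hρ => pow_ne_zero 2 (ne_of_gt ?_)
  have hpos := Real.rpow_pos_of_pos hρ α
  exact (mul_pos (cos_half_pi_mul_pos hα hα1) hpos).trans_le
    (cos_half_mul_le_norm_rayPoint_add hα hα1 ht hpos.le (abs_of_pos Real.pi_pos).le)

theorem integrableOn_fracKernel_smul {E : Type*} [NormedAddCommGroup E] [NormedSpace ℂ E]
    (hα : 0 < α) (hα1 : α < 1) (ht : 0 ≤ t) {F : ℝ → E} {C : ℝ} (hF : ContinuousOn F (Ioi 0))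
    (hC : ∀ ρ : ℝ, 0 < ρ → ‖F ρ‖ ≤ C * (1 + ρ)⁻¹) :
    IntegrableOn (fun ρ : ℝ => (fracKernel α t ρ : ℂ) • F ρ) (Ioi 0) := by
  refine integrableOn_Ioi_of_norm_le_rpow hα hα1 (C := (Real.cos (α * π / 2) ^ 2)⁻¹ * C)
    ((Complex.continuous_ofReal.comp_continuousOn (continuousOn_fracKernel hα hα1 ht)).smul hF)
    fun ρ hρ => ?_
  have hk := fracKernel_le hα hα1 ht hρ
  have hk0 := fracKernel_nonneg (α := α) (t := t) hρ.le
  calc ‖(fracKernel α t ρ : ℂ) • F ρ‖ = fracKernel α t ρ * ‖F ρ‖ := by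
        rw [norm_smul, Complex.norm_real, Real.norm_of_nonneg hk0]
    _ ≤ ((Real.cos (α * π / 2) ^ 2)⁻¹ * ρ ^ (-α)) * (C * (1 + ρ)⁻¹) :=
        mul_le_mul hk (hC ρ hρ) (norm_nonneg _) (hk0.trans hk)
    _ = _ := by ring

theorem integrableOn_fracKernel_mul_inv_add (hα : 0 < α) (hα1 : α < 1) (ht : 0 ≤ t) {z : ℂ}
    (hz : z ∈ Complex.slitPlane) :
    IntegrableOn (fun ρ : ℝ => (fracKernel α t ρ : ℂ) * (z + ρ)⁻¹) (Ioi 0) :=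
  integrableOn_fracKernel_smul hα hα1 ht
    ((continuousOn_inv_add_ofReal hz).mono Ioi_subset_Ici_self)
    fun _ hρ => norm_inv_add_ofReal_le hz hρ.le

theorem sin_div_pi_mul_integral_fracKernel (hα : 0 < α) (hα1 : α < 1) (ht : 0 ≤ t) {z : ℂ}
    (hz : z ∈ Complex.slitPlane) :
    (Real.sin (π * α) / π : ℝ) * ∫ ρ in Ioi (0 : ℝ), (fracKernel α t ρ : ℂ) * (z + ρ)⁻¹
      = (z ^ (α : ℂ) + t)⁻¹ := by
  have hd {w : ℂ} (hw : w ∈ univ ×ℂ Icc (-π) π) : DifferentiableAt ℂ (invPowAdd α t) w :=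
    differentiableAt_invPowAdd hα hα1 ht (abs_le.2 hw.2)
  have hcauchy := integral_inv_add_smul_sub_comp_log hα hα1 hz
    (fun w hw => (hd hw).continuousAt.continuousWithinAt)
    (fun w hw => (hd ⟨hw.1, Ioo_subset_Icc_self hw.2⟩).differentiableWithinAt)
    fun w hw => norm_invPowAdd_le hα hα1 ht (abs_le.2 hw.2)
  have hjump : EqOn (fun ρ : ℝ => (z + ρ)⁻¹ • (invPowAdd α t (Real.log ρ + (-π : ℝ) * Complex.I)
      - invPowAdd α t (Real.log ρ + π * Complex.I)))
      (fun ρ => 2 * Complex.I * Real.sin (π * α) * (fracKernel α t ρ * (z + ρ)⁻¹)) (Ioi 0) :=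
    fun ρ hρ => by
      simp only [invPowAdd_neg_pi_sub_pi hρ, smul_eq_mul]
      ring
  rw [setIntegral_congr_fun measurableSet_Ioi hjump, integral_const_mul, smul_eq_mul,
    invPowAdd_log α t (Complex.slitPlane_ne_zero hz)] at hcauchy
  refine mul_left_cancel₀ Complex.two_pi_I_ne_zero (Eq.trans ?_ hcauchy)
  have hpi : (π : ℂ) ≠ 0 := Complex.ofReal_ne_zero.2 Real.pi_ne_zero
  push_cast
  field_simp

end FracKernel

section Keyhole

variable {E : Type*} [NormedAddCommGroup E] {F G : ℂ → E} {δ θ φ₁ φ₂ p C : ℝ} {z : ℂ}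

/-- The part of the sector `φ₁ ≤ arg z ≤ φ₂` outside the open disc of radius `δ`. The angles are not
reduced modulo `2π`, so that a sector may cross the negative real axis. -/
def truncatedSector (δ φ₁ φ₂ : ℝ) : Set ℂ := image2 rayPoint (Ici δ) (Icc φ₁ φ₂)

/-- The points of the contour of `keyholeIntegral`: two rays and a circular arc. -/
def keyholeContour (δ θ : ℝ) : Set ℂ :=
  image2 rayPoint (Ici δ) {θ, -θ} ∪ rayPoint δ '' Icc (-θ) θ

/-- The closed region to the left of the contour of `keyholeIntegral`. -/
def leftOfKeyhole (δ θ : ℝ) : Set ℂ :=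
  Metric.closedBall 0 δ ∪ truncatedSector δ θ (2 * Real.pi - θ)

theorem le_norm_of_mem_truncatedSector (hδ : 0 ≤ δ) (hz : z ∈ truncatedSector δ φ₁ φ₂) :
    δ ≤ ‖z‖ := by
  obtain ⟨r, hr, φ, -, rfl⟩ := hz
  rwa [norm_rayPoint (hδ.trans hr)]

theorem abs_arg_le_of_mem_truncatedSector (hδ : 0 < δ) (hθ : θ < Real.pi)
    (hz : z ∈ truncatedSector δ (-θ) θ) : |z.arg| ≤ θ := by
  obtain ⟨r, hr, φ, hφ, rfl⟩ := hz
  rw [arg_rayPoint (hδ.trans_le hr) ⟨by linarith [hφ.1], hφ.2.trans hθ.le⟩]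
  exact abs_le.2 hφ

theorem le_abs_arg_of_mem_truncatedSector (hδ : 0 < δ) (hθ : 0 ≤ θ)
    (hz : z ∈ truncatedSector δ θ (2 * Real.pi - θ)) : θ ≤ |z.arg| := by
  obtain ⟨r, hr, φ, hφ, rfl⟩ := hz
  have hr0 : 0 < r := hδ.trans_le hr
  rcases le_or_gt φ Real.pi with hle | hgt
  · rw [arg_rayPoint hr0 ⟨by linarith [Real.pi_pos, hφ.1], hle⟩]
    exact hφ.1.trans (le_abs_self φ)
  · rw [← (rayPoint_periodic r).sub_eq, arg_rayPoint hr0 ⟨by linarith, by linarith [hφ.2]⟩]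
    exact le_abs.2 (Or.inr (by linarith [hφ.2]))

theorem truncatedSector_subset_slitPlane (hδ : 0 < δ) (hθ : θ < Real.pi) :
    truncatedSector δ (-θ) θ ⊆ Complex.slitPlane := fun z hz => by
  refine Complex.mem_slitPlane_iff_arg.2 ⟨fun h => ?_, norm_pos_iff.1
    (hδ.trans_le (le_norm_of_mem_truncatedSector hδ.le hz))⟩
  linarith [(abs_le.1 (abs_arg_le_of_mem_truncatedSector hδ hθ hz)).2]

theorem exp_mem_truncatedSector {a : ℝ} {w : ℂ} (hw : w ∈ Ici a ×ℂ Icc φ₁ φ₂) :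
    Complex.exp w ∈ truncatedSector (Real.exp a) φ₁ φ₂ :=
  ⟨Real.exp w.re, Real.exp_le_exp.2 hw.1, w.im, hw.2, by
    rw [← exp_ofReal_add_mul_I, Complex.re_add_im]⟩

theorem upperRay_mem_keyholeContour {r : ℝ} (hr : δ ≤ r) : rayPoint r θ ∈ keyholeContour δ θ :=
  Or.inl ⟨r, hr, θ, by simp, rfl⟩

theorem lowerRay_mem_keyholeContour {r : ℝ} (hr : δ ≤ r) : rayPoint r (-θ) ∈ keyholeContour δ θ :=
  Or.inl ⟨r, hr, -θ, by simp, rfl⟩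

theorem arc_mem_keyholeContour (hθ : 0 ≤ θ) {φ : ℝ} (hφ : φ ∈ uIcc θ (-θ)) :
    rayPoint δ φ ∈ keyholeContour δ θ :=
  Or.inr ⟨φ, by rwa [uIcc_of_ge (neg_le_self hθ)] at hφ, rfl⟩

theorem neg_ofReal_mem_leftOfKeyhole (hθ : θ ≤ Real.pi) {ρ : ℝ} (hρ : 0 ≤ ρ) :
    -(ρ : ℂ) ∈ leftOfKeyhole δ θ := by
  rcases le_total ρ δ with hle | hle
  · exact Or.inl (by simpa [abs_of_nonneg hρ] using hle)
  · exact Or.inr ⟨ρ, hle, Real.pi, ⟨hθ, by linarith⟩, rayPoint_pi ρ⟩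

theorem keyholeContour_subset_leftOfKeyhole (hδ : 0 ≤ δ) (hθ : θ ≤ Real.pi) :
    keyholeContour δ θ ⊆ leftOfKeyhole δ θ := by
  rintro _ (⟨r, hr, φ, rfl | rfl, rfl⟩ | ⟨φ, -, rfl⟩)
  · exact Or.inr ⟨r, hr, φ, ⟨le_rfl, by linarith⟩, rfl⟩
  · exact Or.inr ⟨r, hr, 2 * Real.pi - θ, ⟨by linarith, le_rfl⟩, by
      rw [← rayPoint_periodic r (-θ), neg_add_eq_sub]⟩
  · exact Or.inl (by rw [mem_closedBall_zero_iff, norm_rayPoint hδ])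

theorem keyholeContour_subset_truncatedSector (hθ : 0 ≤ θ) :
    keyholeContour δ θ ⊆ truncatedSector δ (-θ) θ := by
  rintro _ (⟨r, hr, φ, rfl | rfl, rfl⟩ | ⟨φ, hφ, rfl⟩)
  · exact ⟨r, hr, φ, ⟨neg_le_self hθ, le_rfl⟩, rfl⟩
  · exact ⟨r, hr, -θ, ⟨le_rfl, neg_le_self hθ⟩, rfl⟩
  · exact ⟨δ, self_mem_Ici, φ, hφ, rfl⟩

namespace KeyholeIntegrable

theorem of_norm_le (hδ : 0 < δ) (hθ : 0 ≤ θ) (hp : 1 < p)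
    (hF : ContinuousOn F (keyholeContour δ θ))
    (hC : ∀ z ∈ keyholeContour δ θ, ‖F z‖ ≤ C * ‖z‖ ^ (-p)) : KeyholeIntegrable δ θ F := by
  have hray {φ : ℝ} (hmem : ∀ r ∈ Ici δ, rayPoint r φ ∈ keyholeContour δ θ) :
      IntegrableOn (fun r : ℝ => F (rayPoint r φ)) (Ioi δ) := by
    refine Integrable.mono'
      ((integrableOn_Ioi_rpow_of_lt (a := -p) (by linarith) hδ).const_mul C)
      ((hF.comp (continuous_rayPoint_left φ).continuousOn
        fun r hr => hmem r (Ioi_subset_Ici_self hr)).aestronglyMeasurable measurableSet_Ioi) ?_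
    filter_upwards [ae_restrict_mem measurableSet_Ioi] with r hr
    simpa only [norm_rayPoint (hδ.trans hr).le] using hC _ (hmem r (Ioi_subset_Ici_self hr))
  exact ⟨hray fun r hr => upperRay_mem_keyholeContour hr,
    (hF.comp (continuous_rayPoint_right δ).continuousOn
      fun φ hφ => arc_mem_keyholeContour hθ hφ).intervalIntegrable,
    hray fun r hr => lowerRay_mem_keyholeContour hr⟩

theorem add (hF : KeyholeIntegrable δ θ F) (hG : KeyholeIntegrable δ θ G) :
    KeyholeIntegrable δ θ (fun z => F z + G z) :=
  ⟨hF.1.add hG.1, hF.2.1.add hG.2.1, hF.2.2.add hG.2.2⟩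

end KeyholeIntegrable

variable [NormedSpace ℂ E]

theorem KeyholeIntegrable.const_smul (c : ℂ) (hF : KeyholeIntegrable δ θ F) :
    KeyholeIntegrable δ θ (fun z => c • F z) :=
  ⟨hF.1.smul c, hF.2.1.smul c, hF.2.2.smul c⟩

theorem keyholeIntegral_congr (hθ : 0 ≤ θ) (h : EqOn F G (keyholeContour δ θ)) :
    keyholeIntegral δ θ F = keyholeIntegral δ θ G := by
  unfold keyholeIntegral
  congr 1
  · congr 1
    · exact congrArg _ <| setIntegral_congr_fun measurableSet_Ioi fun r hr =>
        congrArg _ (h (upperRay_mem_keyholeContour (le_of_lt hr)))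
    · exact intervalIntegral.integral_congr fun φ hφ =>
        congrArg _ (h (arc_mem_keyholeContour hθ hφ))
  · exact setIntegral_congr_fun measurableSet_Ioi fun r hr =>
      congrArg _ (h (lowerRay_mem_keyholeContour (le_of_lt hr)))

theorem KeyholeIntegrable.arc_smul (hF : KeyholeIntegrable δ θ F) :
    IntervalIntegrable (fun φ : ℝ => (Complex.I * rayPoint δ φ) • F (rayPoint δ φ))
      volume θ (-θ) :=
  hF.2.1.continuousOn_smul ((continuous_rayPoint_right δ).const_mul _).continuousOn

theorem keyholeIntegral_add (hF : KeyholeIntegrable δ θ F) (hG : KeyholeIntegrable δ θ G) :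
    keyholeIntegral δ θ (fun z => F z + G z)
      = keyholeIntegral δ θ F + keyholeIntegral δ θ G := by
  simp only [keyholeIntegral, integral_smul]
  rw [integral_add hF.1 hG.1, integral_add hF.2.2 hG.2.2]
  simp only [smul_add, intervalIntegral.integral_add hF.arc_smul hG.arc_smul]
  abel

theorem keyholeIntegral_clm_comp {E' : Type*} [NormedAddCommGroup E'] [NormedSpace ℂ E']
    [CompleteSpace E] [CompleteSpace E'] (L : E →L[ℂ] E') (hF : KeyholeIntegrable δ θ F) :
    keyholeIntegral δ θ (fun z => L (F z)) = L (keyholeIntegral δ θ F) := by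
  simp only [keyholeIntegral, integral_smul, map_add, map_neg, map_smul,
    ← L.integral_comp_comm hF.1, ← L.integral_comp_comm hF.2.2,
    ← L.intervalIntegral_comp_comm hF.arc_smul]

theorem keyholeIntegral_const_smul [CompleteSpace E] (c : ℂ) (hF : KeyholeIntegrable δ θ F) :
    keyholeIntegral δ θ (fun z => c • F z) = c • keyholeIntegral δ θ F :=
  keyholeIntegral_clm_comp (c • ContinuousLinearMap.id ℂ E) hF

theorem keyholeIntegral_mul_const {𝔸 : Type*} [NormedRing 𝔸] [NormedAlgebra ℂ 𝔸]
    [CompleteSpace 𝔸] {f : ℂ → 𝔸} (hf : KeyholeIntegrable δ θ f) (a : 𝔸) :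
    keyholeIntegral δ θ (fun z => f z * a) = keyholeIntegral δ θ f * a :=
  keyholeIntegral_clm_comp ((ContinuousLinearMap.mul ℂ 𝔸).flip a) hf

theorem commute_keyholeIntegral {𝔸 : Type*} [NormedRing 𝔸] [NormedAlgebra ℂ 𝔸] [CompleteSpace 𝔸]
    {f : ℂ → 𝔸} {a : 𝔸} (hθ : 0 ≤ θ) (hf : KeyholeIntegrable δ θ f)
    (h : ∀ z ∈ keyholeContour δ θ, Commute (f z) a) : Commute (keyholeIntegral δ θ f) a :=
  calc keyholeIntegral δ θ f * a
    _ = keyholeIntegral δ θ (fun z => f z * a) := (keyholeIntegral_mul_const hf a).symm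
    _ = keyholeIntegral δ θ (fun z => a * f z) := keyholeIntegral_congr hθ fun z hz => h z hz
    _ = a * keyholeIntegral δ θ f :=
      keyholeIntegral_clm_comp (ContinuousLinearMap.mul ℂ 𝔸 a) hf

theorem integral_ray_sub_integral_ray (hδ : 0 < δ) (hφ : φ₁ ≤ φ₂) (hp : 1 < p)
    (hF : ∀ z ∈ truncatedSector δ φ₁ φ₂, DifferentiableAt ℂ F z)
    (hC : ∀ z ∈ truncatedSector δ φ₁ φ₂, ‖F z‖ ≤ C * ‖z‖ ^ (-p)) :
    (∫ r in Ioi δ, Complex.exp ((φ₁ : ℂ) * Complex.I) • F (rayPoint r φ₁))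
      - (∫ r in Ioi δ, Complex.exp ((φ₂ : ℂ) * Complex.I) • F (rayPoint r φ₂))
      = ∫ φ in φ₁..φ₂, (Complex.I * rayPoint δ φ) • F (rayPoint δ φ) := by
  obtain ⟨a, rfl⟩ : ∃ a, Real.exp a = δ := ⟨_, Real.exp_log hδ⟩
  have hdiff : ∀ w ∈ Ici a ×ℂ Icc φ₁ φ₂,
      DifferentiableAt ℂ (fun w => Complex.exp w • F (Complex.exp w)) w := fun w hw =>
    Complex.differentiableAt_exp.smul
      ((hF _ (exp_mem_truncatedSector hw)).comp w Complex.differentiableAt_exp)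
  have hbound : ∀ w ∈ Ici a ×ℂ Icc φ₁ φ₂,
      ‖Complex.exp w • F (Complex.exp w)‖ ≤ C * Real.exp (-(p - 1) * w.re) := fun w hw => by
    have h := hC _ (exp_mem_truncatedSector hw)
    rw [Complex.norm_exp, ← Real.exp_mul] at h
    rw [norm_smul, Complex.norm_exp]
    refine (mul_le_mul_of_nonneg_left h (Real.exp_nonneg _)).trans_eq ?_
    rw [mul_left_comm, ← Real.exp_add]
    congr 2
    ring
  have hedge (φ : ℝ) : (∫ x in Ioi a, Complex.exp (x + φ * Complex.I) •
        F (Complex.exp (x + φ * Complex.I)))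
      = ∫ r in Ioi (Real.exp a), Complex.exp (φ * Complex.I) • F (rayPoint r φ) := by
    rw [← integral_comp_exp_Ioi]
    simp only [exp_ofReal_add_mul_I]
    simp only [rayPoint, mul_smul, Complex.coe_smul]
  have h := integral_Ioi_sub_integral_Ioi_of_halfStrip hφ (sub_pos.2 hp)
    (fun w hw => (hdiff w hw).continuousAt.continuousWithinAt)
    (fun w hw => (hdiff w ⟨Ioi_subset_Ici_self (a := a) hw.1,
      Ioo_subset_Icc_self hw.2⟩).differentiableWithinAt) hbound
  rw [hedge, hedge] at h
  rw [h, ← intervalIntegral.integral_smul]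
  simp only [exp_ofReal_add_mul_I, mul_smul]

theorem keyholeIntegral_eq_zero (hδ : 0 < δ) (hθ : 0 ≤ θ) (hp : 1 < p)
    (hF : ∀ z ∈ truncatedSector δ (-θ) θ, DifferentiableAt ℂ F z)
    (hC : ∀ z ∈ truncatedSector δ (-θ) θ, ‖F z‖ ≤ C * ‖z‖ ^ (-p)) :
    keyholeIntegral δ θ F = 0 := by
  rw [keyholeIntegral, intervalIntegral.integral_symm,
    ← integral_ray_sub_integral_ray hδ (neg_le_self hθ) hp hF hC]
  abel

theorem keyholeIntegral_eq_neg_circleIntegral (hδ : 0 < δ) (hθ : θ ≤ Real.pi) (hp : 1 < p)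
    (hFδ : ContinuousOn F (Metric.sphere 0 δ))
    (hF : ∀ z ∈ truncatedSector δ θ (2 * Real.pi - θ), DifferentiableAt ℂ F z)
    (hC : ∀ z ∈ truncatedSector δ θ (2 * Real.pi - θ), ‖F z‖ ≤ C * ‖z‖ ^ (-p)) :
    keyholeIntegral δ θ F = -∮ z in C(0, δ), F z := by
  have hper (r : ℝ) : rayPoint r (2 * Real.pi - θ) = rayPoint r (-θ) := by
    rw [← rayPoint_periodic r (-θ), neg_add_eq_sub]
  have hexp : Complex.exp (((2 * Real.pi - θ : ℝ) : ℂ) * Complex.I)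
      = Complex.exp (((-θ : ℝ) : ℂ) * Complex.I) := by
    simpa only [rayPoint, Complex.ofReal_one, one_mul] using hper 1
  have harc : Continuous fun φ : ℝ => (Complex.I * rayPoint δ φ) • F (rayPoint δ φ) :=
    ((continuous_rayPoint_right δ).const_mul _).smul
      (hFδ.comp_continuous (continuous_rayPoint_right δ) fun φ => by
        rw [mem_sphere_zero_iff_norm, norm_rayPoint hδ.le])
  have hcauchy := integral_ray_sub_integral_ray hδ (by linarith) hp hF hC
  simp only [hper, hexp] at hcauchy
  rw [← integral_arc_eq_circleIntegral δ (-θ), neg_add_eq_sub,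
    ← intervalIntegral.integral_add_adjacent_intervals (harc.intervalIntegrable (-θ) θ)
      (harc.intervalIntegrable θ (2 * Real.pi - θ)), ← hcauchy, keyholeIntegral,
    intervalIntegral.integral_symm]
  abel

theorem keyholeIntegral_inv_smul [CompleteSpace E] (hδ : 0 < δ) (hθ : θ ≤ Real.pi) (hp : 0 < p)
    (hF : ∀ z ∈ leftOfKeyhole δ θ, DifferentiableAt ℂ F z)
    (hC : ∀ z ∈ truncatedSector δ θ (2 * Real.pi - θ), ‖F z‖ ≤ C * ‖z‖ ^ (-p)) :
    keyholeIntegral δ θ (fun z => z⁻¹ • F z) = -((2 * Real.pi * Complex.I : ℂ) • F 0) := by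
  have hcircle : (∮ z in C(0, δ), z⁻¹ • F z) = (2 * Real.pi * Complex.I : ℂ) • F 0 := by
    simpa only [sub_zero] using
      Complex.circleIntegral_sub_center_inv_smul_of_differentiable_on_off_countable hδ
        (f := F) (c := 0) countable_empty
        (fun z hz => (hF z (Or.inl hz)).continuousAt.continuousWithinAt)
        fun z hz => hF z (Or.inl (Metric.ball_subset_closedBall hz.1))
  have hpos {z : ℂ} (hz : z ∈ truncatedSector δ θ (2 * Real.pi - θ)) : 0 < ‖z‖ :=
    hδ.trans_le (le_norm_of_mem_truncatedSector hδ.le hz)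
  rw [keyholeIntegral_eq_neg_circleIntegral (p := p + 1) (C := C) hδ hθ (by linarith)
    (fun z hz => ?_) (fun z hz => ?_) fun z hz => ?_, hcircle]
  · have hz0 : z ≠ 0 := ne_of_mem_of_not_mem hz (by simpa using hδ.ne)
    exact ((continuousAt_inv₀ hz0).smul (hF z (Or.inl
      (Metric.sphere_subset_closedBall hz))).continuousAt).continuousWithinAt
  · exact (differentiableAt_inv (norm_pos_iff.1 (hpos hz))).smul (hF z (Or.inr hz))
  · rw [norm_smul, norm_inv, neg_add', Real.rpow_sub_one (hpos hz).ne', div_eq_inv_mul,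
      mul_left_comm]
    exact mul_le_mul_of_nonneg_left (hC z hz) (by positivity)

end Keyhole

section StieltjesTransform

variable {E : Type*} [NormedAddCommGroup E] [NormedSpace ℂ E] {W : ℝ → E} {z : ℂ}

/-- The Stieltjes transform `z ↦ ∫ (z + ρ)⁻¹ W(ρ) dρ` over `(0, ∞)`, holomorphic off the negative
real axis. -/
noncomputable def stieltjesTransform (W : ℝ → E) (z : ℂ) : E :=
  ∫ ρ in Ioi (0 : ℝ), (z + ρ)⁻¹ • W ρ

theorem cos_half_arg_mul_norm_pos (hz : z ∈ Complex.slitPlane) :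
    0 < Real.cos (z.arg / 2) * ‖z‖ :=
  mul_pos (cos_half_pos (abs_arg_lt_pi hz)) (norm_pos_iff.2 (Complex.slitPlane_ne_zero hz))

theorem cos_half_arg_mul_norm_le_norm_add (hz : z ∈ Complex.slitPlane) {ρ : ℝ} (hρ : 0 ≤ ρ) :
    Real.cos (z.arg / 2) * ‖z‖ ≤ ‖z + ρ‖ :=
  (mul_le_mul_of_nonneg_left (le_add_of_nonneg_right hρ)
    (cos_half_pos (abs_arg_lt_pi hz)).le).trans (cos_half_arg_mul_add_le_norm_add z ρ)

theorem norm_inv_add_smul_le (hz : z ∈ Complex.slitPlane) {ρ : ℝ} (hρ : 0 ≤ ρ) (v : E) :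
    ‖(z + ρ : ℂ)⁻¹ • v‖ ≤ (Real.cos (z.arg / 2) * ‖z‖)⁻¹ * ‖v‖ := by
  rw [norm_smul, norm_inv]
  exact mul_le_mul_of_nonneg_right (inv_anti₀ (cos_half_arg_mul_norm_pos hz)
    (cos_half_arg_mul_norm_le_norm_add hz hρ)) (norm_nonneg v)

theorem integrableOn_inv_add_smul (hW : IntegrableOn W (Ioi 0)) (hz : z ∈ Complex.slitPlane) :
    IntegrableOn (fun ρ : ℝ => (z + ρ : ℂ)⁻¹ • W ρ) (Ioi 0) := by
  refine Integrable.mono' (hW.norm.const_mul (Real.cos (z.arg / 2) * ‖z‖)⁻¹) ?_ ?_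
  · exact (((continuousOn_inv_add_ofReal hz).mono Ioi_subset_Ici_self).aestronglyMeasurable
      measurableSet_Ioi).smul hW.1
  · exact (ae_restrict_mem measurableSet_Ioi).mono
      fun ρ hρ => norm_inv_add_smul_le hz (le_of_lt hρ) (W ρ)

theorem norm_stieltjesTransform_le (hW : IntegrableOn W (Ioi 0)) (hz : z ∈ Complex.slitPlane) :
    ‖stieltjesTransform W z‖
      ≤ (Real.cos (z.arg / 2) * ‖z‖)⁻¹ * ∫ ρ in Ioi (0 : ℝ), ‖W ρ‖ := by
  rw [← integral_const_mul]
  exact norm_integral_le_of_norm_le (hW.norm.const_mul _) <|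
    (ae_restrict_mem measurableSet_Ioi).mono
      fun ρ hρ => norm_inv_add_smul_le hz (le_of_lt hρ) (W ρ)

theorem differentiableAt_stieltjesTransform (hW : IntegrableOn W (Ioi 0))
    (hz : z ∈ Complex.slitPlane) : DifferentiableAt ℂ (stieltjesTransform W) z := by
  set m : ℂ → ℝ := fun w => Real.cos (w.arg / 2) * ‖w‖
  have hm : ContinuousAt m z :=
    (Real.continuous_cos.continuousAt.comp ((Complex.continuousAt_arg hz).div_const 2)).mul
      continuous_norm.continuousAt
  have hnear : {w | w ∈ Complex.slitPlane ∧ m z / 2 < m w} ∈ nhds z :=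
    Filter.inter_mem (Complex.isOpen_slitPlane.mem_nhds hz)
      (hm.eventually (lt_mem_nhds (half_lt_self (cos_half_arg_mul_norm_pos hz))))
  have hmpos : 0 < m z / 2 := half_pos (cos_half_arg_mul_norm_pos hz)
  refine (hasDerivAt_integral_of_dominated_loc_of_deriv_le
    (F := fun (w : ℂ) (ρ : ℝ) => (w + ρ)⁻¹ • W ρ)
    (F' := fun (w : ℂ) (ρ : ℝ) => -((w + ρ) ^ 2)⁻¹ • W ρ)
    (bound := fun ρ => ((m z / 2) ^ 2)⁻¹ * ‖W ρ‖) hnear ?_ (integrableOn_inv_add_smul hW hz) ?_ ?_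
    (hW.norm.const_mul _) ?_).2.differentiableAt
  · exact Filter.mem_of_superset hnear fun w hw => (integrableOn_inv_add_smul hW hw.1).1
  · simp only [neg_smul, ← inv_pow]
    exact ((((continuousOn_inv_add_ofReal hz).pow 2).mono
      Ioi_subset_Ici_self).aestronglyMeasurable measurableSet_Ioi).smul hW.1 |>.neg
  · filter_upwards [ae_restrict_mem measurableSet_Ioi] with ρ hρ w hw
    have hle := hw.2.le.trans (cos_half_arg_mul_norm_le_norm_add hw.1 (le_of_lt hρ))
    rw [norm_smul, norm_neg, norm_inv, norm_pow]
    gcongr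
  · filter_upwards [ae_restrict_mem measurableSet_Ioi] with ρ hρ w hw
    have hne := add_ofReal_ne_zero hw.1 (le_of_lt hρ)
    exact ((hasDerivAt_inv hne).comp_add_const w (ρ : ℂ)).smul_const (W ρ)

end StieltjesTransform

section Sectorial

variable {X : Type*} [NormedAddCommGroup X] [NormedSpace ℂ X] {B : X →ₗ.[ℂ] X} {δ θ : ℝ}

/-- The operator `B` is sectorial for the contour of `keyholeIntegral`: the closed region to the
left of the contour, which contains the origin and the negative real axis, lies in the resolvent
set, and `‖(z I - B)⁻¹‖ ≤ M / (1 + ‖z‖)` there. The weight `1 + ‖z‖` covers the disc and the sector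
by a single estimate. -/
structure IsSectorial (B : X →ₗ.[ℂ] X) (δ θ : ℝ) : Prop where
  radius_pos : 0 < δ
  angle_nonneg : 0 ≤ θ
  angle_lt_pi : θ < Real.pi
  leftOfKeyhole_subset : leftOfKeyhole δ θ ⊆ resolventSetOf B
  exists_norm_le : ∃ M, ∀ z ∈ leftOfKeyhole δ θ, (1 + ‖z‖) * ‖resolventOf B z‖ ≤ M

theorem truncatedSector_subset_negSector {η : ℝ} (hδ : 0 < δ) (hθ : 0 ≤ θ)
    (hη : Real.pi - θ < η) : truncatedSector δ θ (2 * Real.pi - θ) ⊆ negSector η := fun z hz => by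
  have hz' := le_abs_arg_of_mem_truncatedSector hδ hθ hz
  change Real.pi - |z.arg| < η
  linarith

theorem isSectorial_of_negSector_union_ball_subset [CompleteSpace X] {ω lam : ℝ}
    (hres : negSector ω ∪ Metric.ball (0 : ℂ) lam ⊆ resolventSetOf B)
    (hbound : ∀ η : ℝ, 0 < η → η < ω → ∃ M : ℝ, ∀ z ∈ negSector η,
      ‖z‖ * ‖resolventOf B z‖ ≤ M)
    (hδ : 0 < δ) (hδlam : δ < lam) (hθ : 0 ≤ θ) (hωθ : Real.pi - ω < θ) (hθpi : θ < Real.pi) :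
    IsSectorial B δ θ := by
  obtain ⟨η, hθη, hηω⟩ := exists_between (sub_lt_comm.1 hωθ)
  obtain ⟨M, hM⟩ := hbound η ((sub_pos.2 hθpi).trans hθη) hηω
  have hdisc : Metric.closedBall 0 δ ⊆ resolventSetOf B := fun z hz =>
    hres (Or.inr (Metric.closedBall_subset_ball hδlam hz))
  obtain ⟨C, hC⟩ := (isCompact_closedBall (0 : ℂ) δ).exists_bound_of_continuousOn fun z hz =>
    (differentiableAt_resolventOf (hdisc hz)).continuousAt.continuousWithinAt
  refine ⟨hδ, hθ, hθpi, union_subset hdisc fun z hz => hres (Or.inl ?_),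
    max ((1 + δ) * C) ((δ⁻¹ + 1) * M), ?_⟩
  · exact truncatedSector_subset_negSector hδ hθ (sub_lt_comm.1 hωθ) hz
  · rintro z (hz | hz)
    · refine le_max_of_le_left ?_
      gcongr
      exacts [mem_closedBall_zero_iff.1 hz, hC z hz]
    · have hδz : 1 ≤ δ⁻¹ * ‖z‖ :=
        (one_le_inv_mul₀ hδ).2 (le_norm_of_mem_truncatedSector hδ.le hz)
      calc (1 + ‖z‖) * ‖resolventOf B z‖
          ≤ (δ⁻¹ * ‖z‖ + ‖z‖) * ‖resolventOf B z‖ := by gcongr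
        _ = (δ⁻¹ + 1) * (‖z‖ * ‖resolventOf B z‖) := by ring
        _ ≤ (δ⁻¹ + 1) * M := by
            gcongr
            exact hM z (truncatedSector_subset_negSector hδ hθ hθη hz)
        _ ≤ _ := le_max_right _ _

namespace IsSectorial

theorem contour_subset (h : IsSectorial B δ θ) : keyholeContour δ θ ⊆ resolventSetOf B :=
  (keyholeContour_subset_leftOfKeyhole h.radius_pos.le h.angle_lt_pi.le).trans
    h.leftOfKeyhole_subset

theorem contour_subset_slitPlane (h : IsSectorial B δ θ) :
    keyholeContour δ θ ⊆ Complex.slitPlane :=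
  (keyholeContour_subset_truncatedSector h.angle_nonneg).trans
    (truncatedSector_subset_slitPlane h.radius_pos h.angle_lt_pi)

theorem zero_mem (h : IsSectorial B δ θ) : (0 : ℂ) ∈ resolventSetOf B :=
  h.leftOfKeyhole_subset (Or.inl (Metric.mem_closedBall_self h.radius_pos.le))

theorem neg_ofReal_mem (h : IsSectorial B δ θ) {ρ : ℝ} (hρ : 0 ≤ ρ) :
    -(ρ : ℂ) ∈ resolventSetOf B :=
  h.leftOfKeyhole_subset (neg_ofReal_mem_leftOfKeyhole h.angle_lt_pi.le hρ)

theorem isBoundedInverse_neg_resolventOf_zero (h : IsSectorial B δ θ) :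
    IsBoundedInverse B (-resolventOf B 0) := by
  simpa only [neg_zero, addScalar_zero] using
    isBoundedInverse_neg_resolventOf_neg (B := B) (z := 0)
      (by simpa only [neg_zero] using h.zero_mem)

theorem exists_norm_resolventOf_le (h : IsSectorial B δ θ) :
    ∃ M, ∀ z ∈ leftOfKeyhole δ θ, z ≠ 0 → ‖resolventOf B z‖ ≤ M * ‖z‖ ^ (-1 : ℝ) := by
  obtain ⟨M, hM⟩ := h.exists_norm_le
  refine ⟨M, fun z hz hz0 => ?_⟩
  rw [Real.rpow_neg_one, ← div_eq_mul_inv, le_div_iff₀' (norm_pos_iff.2 hz0)]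
  refine le_trans ?_ (hM z hz)
  gcongr
  exact le_add_of_nonneg_left zero_le_one

theorem exists_norm_boundedInverse_addScalar_le (h : IsSectorial B δ θ) :
    ∃ M, ∀ ρ : ℝ, 0 < ρ → ‖boundedInverse (addScalar (ρ : ℂ) B)‖ ≤ M * (1 + ρ)⁻¹ := by
  obtain ⟨M, hM⟩ := h.exists_norm_le
  refine ⟨M, fun ρ hρ => ?_⟩
  have hle := hM _ (neg_ofReal_mem_leftOfKeyhole h.angle_lt_pi.le hρ.le)
  rw [norm_neg, Complex.norm_of_nonneg hρ.le] at hle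
  rwa [boundedInverse_addScalar (h.neg_ofReal_mem hρ.le), norm_neg, ← div_eq_mul_inv,
    le_div_iff₀' (by positivity)]

variable [CompleteSpace X]

theorem continuousOn_boundedInverse_addScalar (h : IsSectorial B δ θ) :
    ContinuousOn (fun ρ : ℝ => boundedInverse (addScalar (ρ : ℂ) B)) (Ioi 0) := by
  refine ContinuousOn.congr (f := fun ρ : ℝ => -resolventOf B (-(ρ : ℂ))) (fun ρ hρ => ?_)
    fun ρ hρ => boundedInverse_addScalar (h.neg_ofReal_mem (le_of_lt hρ))
  have hR := (differentiableAt_resolventOf (h.neg_ofReal_mem (le_of_lt hρ))).continuousAt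
  exact (ContinuousAt.comp (f := fun ρ : ℝ => -(ρ : ℂ)) hR
    (by fun_prop)).neg.continuousWithinAt

theorem keyholeIntegrable_cpow_smul (h : IsSectorial B δ θ) {s : ℝ} (hs : s < 0) :
    KeyholeIntegrable δ θ (fun z : ℂ => z ^ (s : ℂ) • resolventOf B z) := by
  obtain ⟨M, hM⟩ := h.exists_norm_resolventOf_le
  refine .of_norm_le (p := 1 - s) (C := M) h.radius_pos h.angle_nonneg (by linarith)
    (fun z hz => ?_) fun z hz => ?_
  · exact ((continuousAt_cpow_const (h.contour_subset_slitPlane hz)).smul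
      (differentiableAt_resolventOf (h.contour_subset hz)).continuousAt).continuousWithinAt
  · have hz0 := Complex.slitPlane_ne_zero (h.contour_subset_slitPlane hz)
    rw [norm_smul, Complex.norm_cpow_real, neg_sub, sub_eq_add_neg,
      Real.rpow_add (norm_pos_iff.2 hz0), mul_left_comm]
    gcongr
    exact hM z (keyholeContour_subset_leftOfKeyhole h.radius_pos.le h.angle_lt_pi.le hz) hz0

theorem keyholeIntegrable_inv_smul (h : IsSectorial B δ θ) :
    KeyholeIntegrable δ θ (fun z : ℂ => z⁻¹ • resolventOf B z) := by
  simpa only [Complex.ofReal_neg, Complex.ofReal_one, Complex.cpow_neg_one] using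
    h.keyholeIntegrable_cpow_smul (s := -1) (by norm_num)

theorem keyholeIntegral_inv_smul_resolventOf (h : IsSectorial B δ θ) :
    keyholeIntegral δ θ (fun z : ℂ => z⁻¹ • resolventOf B z)
      = -((2 * (Real.pi : ℂ) * Complex.I) • resolventOf B 0) := by
  obtain ⟨M, hM⟩ := h.exists_norm_resolventOf_le
  refine keyholeIntegral_inv_smul h.radius_pos h.angle_lt_pi.le one_pos
    (fun z hz => differentiableAt_resolventOf (h.leftOfKeyhole_subset hz)) fun z hz =>
      hM z (Or.inr hz) (norm_pos_iff.1 ?_)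
  exact h.radius_pos.trans_le (le_norm_of_mem_truncatedSector h.radius_pos.le hz)

end IsSectorial

end Sectorial

section ShiftedSymbol

variable {E : Type*} [NormedAddCommGroup E] [NormedSpace ℂ E] {δ θ α t : ℝ} {z : ℂ}

/-- The symbol `z ^ (α - 1) + t z⁻¹` of the operator `B ^ (α - 1) + t B⁻¹ = B⁻¹ (B ^ α + t)`. -/
noncomputable def shiftedSymbol (α t : ℝ) (z : ℂ) : ℂ := z ^ ((α - 1 : ℝ) : ℂ) + t * z⁻¹

theorem shiftedSymbol_smul {V : Type*} [AddCommGroup V] [Module ℂ V] (α t : ℝ) (z : ℂ) (v : V) :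
    shiftedSymbol α t z • v = z ^ ((α - 1 : ℝ) : ℂ) • v + (t : ℂ) • z⁻¹ • v := by
  rw [shiftedSymbol, add_smul, mul_smul]

theorem shiftedSymbol_mul_inv (hα : 0 < α) (hα1 : α < 1) (ht : 0 ≤ t) (hz : z ≠ 0) :
    shiftedSymbol α t z * (z ^ (α : ℂ) + t)⁻¹ = z⁻¹ := by
  have hne : z ^ (α : ℂ) + t ≠ 0 := by
    rw [Complex.cpow_def_of_ne_zero hz, mul_comm]
    exact exp_mul_add_ne_zero hα hα1 ht (Complex.log_im z ▸ Complex.abs_arg_le_pi z)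
  rw [shiftedSymbol, Complex.ofReal_sub, Complex.ofReal_one, Complex.cpow_sub _ _ hz,
    Complex.cpow_one, div_eq_mul_inv, ← add_mul, mul_right_comm, mul_inv_cancel₀ hne, one_mul]

theorem differentiableAt_shiftedSymbol (α t : ℝ) (hz : z ∈ Complex.slitPlane) :
    DifferentiableAt ℂ (shiftedSymbol α t) z :=
  (differentiableAt_id.cpow_const hz).add
    ((differentiableAt_inv (Complex.slitPlane_ne_zero hz)).const_mul _)

theorem norm_shiftedSymbol_le (hδ : 0 < δ) (hα : 0 ≤ α) (ht : 0 ≤ t) (hz : δ ≤ ‖z‖) :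
    ‖shiftedSymbol α t z‖ ≤ (1 + t * δ ^ (-α)) * ‖z‖ ^ (α - 1) := by
  have hz0 : 0 < ‖z‖ := hδ.trans_le hz
  have hinv : ‖z‖⁻¹ ≤ δ ^ (-α) * ‖z‖ ^ (α - 1) :=
    calc ‖z‖⁻¹ = ‖z‖ ^ (-α) * ‖z‖ ^ (α - 1) := by
          rw [← Real.rpow_add hz0, add_sub, neg_add_cancel, zero_sub, Real.rpow_neg_one]
      _ ≤ δ ^ (-α) * ‖z‖ ^ (α - 1) :=
          mul_le_mul_of_nonneg_right (Real.rpow_le_rpow_of_nonpos hδ hz (neg_nonpos.2 hα))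
            (by positivity)
  calc ‖shiftedSymbol α t z‖ ≤ ‖z ^ ((α - 1 : ℝ) : ℂ)‖ + ‖t * z⁻¹‖ := norm_add_le _ _
    _ = ‖z‖ ^ (α - 1) + t * ‖z‖⁻¹ := by
        rw [Complex.norm_cpow_real, norm_mul, norm_inv, Complex.norm_of_nonneg ht]
    _ ≤ ‖z‖ ^ (α - 1) + t * (δ ^ (-α) * ‖z‖ ^ (α - 1)) := by gcongr
    _ = (1 + t * δ ^ (-α)) * ‖z‖ ^ (α - 1) := by ring

theorem differentiableAt_shiftedSymbol_smul_stieltjesTransform (α t : ℝ) {W : ℝ → E}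
    (hW : IntegrableOn W (Ioi 0)) (hz : z ∈ Complex.slitPlane) :
    DifferentiableAt ℂ (fun z => shiftedSymbol α t z • stieltjesTransform W z) z :=
  (differentiableAt_shiftedSymbol α t hz).smul (differentiableAt_stieltjesTransform hW hz)

theorem exists_norm_shiftedSymbol_smul_stieltjesTransform_le (hδ : 0 < δ) (hθ : θ < Real.pi)
    (hα : 0 ≤ α) (ht : 0 ≤ t) {W : ℝ → E} (hW : IntegrableOn W (Ioi 0)) :
    ∃ C, ∀ z ∈ truncatedSector δ (-θ) θ,
      ‖shiftedSymbol α t z • stieltjesTransform W z‖ ≤ C * ‖z‖ ^ (-(2 - α)) := by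
  refine ⟨(1 + t * δ ^ (-α)) * ((Real.cos (θ / 2))⁻¹ * ∫ ρ in Ioi (0 : ℝ), ‖W ρ‖), fun z hz => ?_⟩
  have hzδ := le_norm_of_mem_truncatedSector hδ.le hz
  have hz0 : 0 < ‖z‖ := hδ.trans_le hzδ
  have harg := abs_arg_le_of_mem_truncatedSector hδ hθ hz
  have hθ0 : 0 < Real.cos (θ / 2) :=
    cos_half_pos (abs_lt.2 ⟨by linarith [abs_nonneg z.arg, Real.pi_pos], hθ⟩)
  have hpow : ‖z‖ ^ (-(2 - α)) = ‖z‖ ^ (α - 1) * ‖z‖⁻¹ := by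
    rw [← div_eq_mul_inv, ← Real.rpow_sub_one hz0.ne']
    ring_nf
  have hW0 : 0 ≤ ∫ ρ in Ioi (0 : ℝ), ‖W ρ‖ := integral_nonneg fun _ => norm_nonneg _
  rw [norm_smul, hpow]
  calc ‖shiftedSymbol α t z‖ * ‖stieltjesTransform W z‖
      ≤ (1 + t * δ ^ (-α)) * ‖z‖ ^ (α - 1) *
          ((Real.cos (z.arg / 2) * ‖z‖)⁻¹ * ∫ ρ in Ioi (0 : ℝ), ‖W ρ‖) := by
        gcongr
        · exact norm_shiftedSymbol_le hδ hα ht hzδ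
        · exact norm_stieltjesTransform_le hW
            (truncatedSector_subset_slitPlane hδ hθ hz)
    _ ≤ (1 + t * δ ^ (-α)) * ‖z‖ ^ (α - 1) *
          ((Real.cos (θ / 2) * ‖z‖)⁻¹ * ∫ ρ in Ioi (0 : ℝ), ‖W ρ‖) := by
        refine mul_le_mul_of_nonneg_left (mul_le_mul_of_nonneg_right ?_ hW0) (by positivity)
        gcongr
        exact cos_half_le_cos_half harg hθ.le
    _ = _ := by
        rw [mul_inv]
        ring

theorem keyholeIntegrable_shiftedSymbol_smul_stieltjesTransform (hδ : 0 < δ) (hθ : 0 ≤ θ)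
    (hθpi : θ < Real.pi) (hα : 0 ≤ α) (hα1 : α < 1) (ht : 0 ≤ t) {W : ℝ → E}
    (hW : IntegrableOn W (Ioi 0)) :
    KeyholeIntegrable δ θ (fun z => shiftedSymbol α t z • stieltjesTransform W z) := by
  obtain ⟨C, hC⟩ := exists_norm_shiftedSymbol_smul_stieltjesTransform_le hδ hθpi hα ht hW
  have hsub := keyholeContour_subset_truncatedSector (δ := δ) hθ
  exact .of_norm_le hδ hθ (p := 2 - α) (by linarith)
    (fun z hz => (differentiableAt_shiftedSymbol_smul_stieltjesTransform α t hW
      (truncatedSector_subset_slitPlane hδ hθpi (hsub hz))).continuousAt.continuousWithinAt)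
    fun z hz => hC z (hsub hz)

theorem keyholeIntegral_shiftedSymbol_smul_stieltjesTransform (hδ : 0 < δ) (hθ : 0 ≤ θ)
    (hθpi : θ < Real.pi) (hα : 0 ≤ α) (hα1 : α < 1) (ht : 0 ≤ t) {W : ℝ → E}
    (hW : IntegrableOn W (Ioi 0)) :
    keyholeIntegral δ θ (fun z => shiftedSymbol α t z • stieltjesTransform W z) = 0 := by
  obtain ⟨C, hC⟩ := exists_norm_shiftedSymbol_smul_stieltjesTransform_le hδ hθpi hα ht hW
  exact keyholeIntegral_eq_zero hδ hθ (p := 2 - α) (by linarith)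
    (fun z hz => differentiableAt_shiftedSymbol_smul_stieltjesTransform α t hW
      (truncatedSector_subset_slitPlane hδ hθpi hz)) hC

end ShiftedSymbol

section Balakrishnan

variable {X : Type*} [NormedAddCommGroup X] [NormedSpace ℂ X] {B : X →ₗ.[ℂ] X}
  {δ θ α t : ℝ} {z : ℂ}

/-- The operator-valued integrand of the formula for `(B ^ α + t)⁻¹`, without the factor
`sin πα / π`. -/
noncomputable def balakrishnanIntegrand (B : X →ₗ.[ℂ] X) (α t ρ : ℝ) : X →L[ℂ] X :=
  (fracKernel α t ρ : ℂ) • boundedInverse (addScalar (ρ : ℂ) B)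

/-- The integral that represents `(B ^ α + t)⁻¹`. -/
noncomputable def balakrishnan (B : X →ₗ.[ℂ] X) (α t : ℝ) : X →L[ℂ] X :=
  ((Real.sin (Real.pi * α) / Real.pi : ℝ) : ℂ) •
    ∫ ρ in Ioi (0 : ℝ), balakrishnanIntegrand B α t ρ

namespace IsSectorial

theorem resolventOf_mul_balakrishnanIntegrand (h : IsSectorial B δ θ) (hz : z ∈ resolventSetOf B)
    (hzs : z ∈ Complex.slitPlane) {ρ : ℝ} (hρ : 0 ≤ ρ) :
    resolventOf B z * balakrishnanIntegrand B α t ρ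
      = ((fracKernel α t ρ : ℂ) * (z + ρ)⁻¹) • resolventOf B z
        + (z + ρ : ℂ)⁻¹ • balakrishnanIntegrand B α t ρ := by
  rw [balakrishnanIntegrand, mul_smul_comm, resolventOf_mul_boundedInverse_addScalar hz
    (h.neg_ofReal_mem hρ) (add_ofReal_ne_zero hzs hρ), smul_add, smul_add, smul_smul, smul_comm]

variable [CompleteSpace X]

theorem integrableOn_balakrishnanIntegrand (h : IsSectorial B δ θ) (hα : 0 < α) (hα1 : α < 1)
    (ht : 0 ≤ t) : IntegrableOn (balakrishnanIntegrand B α t) (Ioi 0) := by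
  obtain ⟨M, hM⟩ := h.exists_norm_boundedInverse_addScalar_le
  exact integrableOn_fracKernel_smul hα hα1 ht h.continuousOn_boundedInverse_addScalar hM

theorem commute_resolventOf_balakrishnan (h : IsSectorial B δ θ) (hα : 0 < α) (hα1 : α < 1)
    (ht : 0 ≤ t) (hz : z ∈ resolventSetOf B) :
    Commute (resolventOf B z) (balakrishnan B α t) := by
  have hint := h.integrableOn_balakrishnanIntegrand hα hα1 ht
  refine Commute.smul_right ?_ _
  rw [Commute, SemiconjBy, ← integral_const_mul_of_integrable hint,
    ← integral_mul_const_of_integrable hint]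
  refine setIntegral_congr_fun measurableSet_Ioi fun ρ hρ => Commute.smul_right ?_ _
  have hmem := h.neg_ofReal_mem (le_of_lt hρ)
  rw [boundedInverse_addScalar hmem]
  exact (commute_resolventOf hz hmem).neg_right

theorem resolventOf_mul_balakrishnan (h : IsSectorial B δ θ) (hα : 0 < α) (hα1 : α < 1)
    (ht : 0 ≤ t) (hz : z ∈ resolventSetOf B) (hzs : z ∈ Complex.slitPlane) :
    resolventOf B z * balakrishnan B α t = (z ^ (α : ℂ) + t)⁻¹ • resolventOf B z
      + ((Real.sin (Real.pi * α) / Real.pi : ℝ) : ℂ) •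
          stieltjesTransform (balakrishnanIntegrand B α t) z := by
  have hint := h.integrableOn_balakrishnanIntegrand hα hα1 ht
  have hker := integrableOn_fracKernel_mul_inv_add hα hα1 ht hzs
  rw [balakrishnan, mul_smul_comm, ← integral_const_mul_of_integrable hint,
    setIntegral_congr_fun measurableSet_Ioi fun ρ hρ =>
      h.resolventOf_mul_balakrishnanIntegrand hz hzs (le_of_lt hρ),
    integral_add (hker.smul_const _) (integrableOn_inv_add_smul hint hzs), integral_smul_const,
    smul_add, smul_smul, sin_div_pi_mul_integral_fracKernel hα hα1 ht hzs, stieltjesTransform]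

theorem keyholeIntegrable_shiftedSymbol_smul (h : IsSectorial B δ θ) (hα1 : α < 1) (t : ℝ) :
    KeyholeIntegrable δ θ (fun z => shiftedSymbol α t z • resolventOf B z) := by
  simp only [shiftedSymbol_smul]
  exact (h.keyholeIntegrable_cpow_smul (sub_neg.2 hα1)).add
    (h.keyholeIntegrable_inv_smul.const_smul _)

theorem keyholeIntegral_shiftedSymbol_smul_resolventOf (h : IsSectorial B δ θ) (hα1 : α < 1)
    (t : ℝ) :
    keyholeIntegral δ θ (fun z => shiftedSymbol α t z • resolventOf B z)
      = (2 * (Real.pi : ℂ) * Complex.I) •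
        (dunfordTaylor B δ θ (α - 1) + (t : ℂ) • -resolventOf B 0) := by
  simp only [shiftedSymbol_smul]
  rw [keyholeIntegral_add (h.keyholeIntegrable_cpow_smul (sub_neg.2 hα1))
      (h.keyholeIntegrable_inv_smul.const_smul _),
    keyholeIntegral_const_smul _ h.keyholeIntegrable_inv_smul,
    h.keyholeIntegral_inv_smul_resolventOf, dunfordTaylor, smul_add,
    smul_inv_smul₀ Complex.two_pi_I_ne_zero, ← smul_neg, smul_comm (t : ℂ)]

theorem keyholeIntegral_shiftedSymbol_smul_resolventOf_mul (h : IsSectorial B δ θ) (hα : 0 < α)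
    (hα1 : α < 1) (ht : 0 ≤ t) :
    keyholeIntegral δ θ (fun z => shiftedSymbol α t z • resolventOf B z) * balakrishnan B α t
      = keyholeIntegral δ θ (fun z => z⁻¹ • resolventOf B z) := by
  have hint := h.integrableOn_balakrishnanIntegrand hα hα1 ht
  have hST := keyholeIntegrable_shiftedSymbol_smul_stieltjesTransform h.radius_pos h.angle_nonneg
    h.angle_lt_pi hα.le hα1 ht hint
  set c : ℂ := ((Real.sin (Real.pi * α) / Real.pi : ℝ) : ℂ)
  have hmul : EqOn (fun z => shiftedSymbol α t z • resolventOf B z * balakrishnan B α t)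
      (fun z => z⁻¹ • resolventOf B z
        + c • shiftedSymbol α t z • stieltjesTransform (balakrishnanIntegrand B α t) z)
      (keyholeContour δ θ) := fun z hz => by
    have hzs := h.contour_subset_slitPlane hz
    simp only [smul_mul_assoc]
    rw [h.resolventOf_mul_balakrishnan hα hα1 ht (h.contour_subset hz) hzs, smul_add, smul_smul,
      shiftedSymbol_mul_inv hα hα1 ht (Complex.slitPlane_ne_zero hzs), smul_comm c]
  rw [← keyholeIntegral_mul_const (h.keyholeIntegrable_shiftedSymbol_smul hα1 t),
    keyholeIntegral_congr h.angle_nonneg hmul,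
    keyholeIntegral_add h.keyholeIntegrable_inv_smul (hST.const_smul c),
    keyholeIntegral_const_smul c hST,
    keyholeIntegral_shiftedSymbol_smul_stieltjesTransform h.radius_pos h.angle_nonneg
      h.angle_lt_pi hα.le hα1 ht hint, smul_zero, add_zero]

theorem dunfordTaylor_add_smul_mul_balakrishnan (h : IsSectorial B δ θ) (hα : 0 < α) (hα1 : α < 1)
    (ht : 0 ≤ t) :
    (dunfordTaylor B δ θ (α - 1) + (t : ℂ) • -resolventOf B 0) * balakrishnan B α t
      = -resolventOf B 0 := by
  have hmul := h.keyholeIntegral_shiftedSymbol_smul_resolventOf_mul hα hα1 ht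
  rw [h.keyholeIntegral_shiftedSymbol_smul_resolventOf hα1, smul_mul_assoc,
    h.keyholeIntegral_inv_smul_resolventOf, ← smul_neg] at hmul
  exact smul_right_injective _ Complex.two_pi_I_ne_zero hmul

theorem commute_dunfordTaylor_balakrishnan (h : IsSectorial B δ θ) (hα : 0 < α) (hα1 : α < 1)
    (ht : 0 ≤ t) : Commute (dunfordTaylor B δ θ (α - 1)) (balakrishnan B α t) :=
  (commute_keyholeIntegral h.angle_nonneg (h.keyholeIntegrable_cpow_smul (sub_neg.2 hα1))
    fun _ hz => (h.commute_resolventOf_balakrishnan hα hα1 ht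
      (h.contour_subset hz)).smul_left _).smul_left _

theorem isBoundedInverse_balakrishnan (h : IsSectorial B δ θ) (hα : 0 < α) (hα1 : α < 1)
    (ht : 0 ≤ t) :
    IsBoundedInverse (addScalar (t : ℂ) (fracPower B δ θ α)) (balakrishnan B α t) :=
  h.isBoundedInverse_neg_resolventOf_zero.addScalar_fracPower
    (h.dunfordTaylor_add_smul_mul_balakrishnan hα hα1 ht)
    (h.commute_dunfordTaylor_balakrishnan hα hα1 ht)
    (h.commute_resolventOf_balakrishnan hα hα1 ht h.zero_mem).neg_left

end IsSectorial

end Balakrishnan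

end UnboundedOp

theorem mainTheorem4 {X : Type*} [NormedAddCommGroup X] [NormedSpace ℂ X] [CompleteSpace X]
    (B : X →ₗ.[ℂ] X) (ω lam : ℝ) (hω : 0 < ω) (hωpi : ω < Real.pi) (hlam : 0 < lam)
    -- the resolvent set contains the sector and the disc
    (hres : UnboundedOp.negSector ω ∪ Metric.ball (0 : ℂ) lam ⊆ UnboundedOp.resolventSetOf B)
    -- `z (z I - B)⁻¹` is bounded on every smaller sector
    (hbound : ∀ η : ℝ, 0 < η → η < ω → ∃ M : ℝ, ∀ z ∈ UnboundedOp.negSector η,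
      ‖z‖ * ‖UnboundedOp.resolventOf B z‖ ≤ M)
    -- the contour in the definition of `B^α`
    (δ θ : ℝ) (hδ : 0 < δ) (hδlam : δ < lam) (hθ : Real.pi - ω < θ) (hθpi : θ < Real.pi)
    (α : ℝ) (hα : 0 < α) (hα1 : α < 1) :
    UnboundedOp.KeyholeIntegrable δ θ
      (fun z : ℂ => z ^ ((α - 1 : ℝ) : ℂ) • UnboundedOp.resolventOf B z) ∧
    (∀ t : ℝ, 0 ≤ t →
      IntegrableOn (fun ρ : ℝ =>
        ((ρ ^ α / (ρ ^ (2 * α) + 2 * t * Real.cos (Real.pi * α) * ρ ^ α + t ^ 2) : ℝ) : ℂ) •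
          UnboundedOp.boundedInverse (UnboundedOp.addScalar (ρ : ℂ) B)) (Ioi 0) ∧
      UnboundedOp.IsBoundedInverse
        (UnboundedOp.addScalar (t : ℂ) (UnboundedOp.fracPower B δ θ α))
        (((Real.sin (Real.pi * α) / Real.pi : ℝ) : ℂ) • ∫ ρ in Ioi (0 : ℝ),
          ((ρ ^ α / (ρ ^ (2 * α) + 2 * t * Real.cos (Real.pi * α) * ρ ^ α + t ^ 2) : ℝ) : ℂ) •
            UnboundedOp.boundedInverse (UnboundedOp.addScalar (ρ : ℂ) B))) ∧
    (IntegrableOn (fun ρ : ℝ => ((ρ ^ (-α) : ℝ) : ℂ) •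
        UnboundedOp.boundedInverse (UnboundedOp.addScalar (ρ : ℂ) B)) (Ioi 0) ∧
      UnboundedOp.IsBoundedInverse (UnboundedOp.fracPower B δ θ α)
        (((Real.sin (Real.pi * α) / Real.pi : ℝ) : ℂ) • ∫ ρ in Ioi (0 : ℝ),
          ((ρ ^ (-α) : ℝ) : ℂ) •
            UnboundedOp.boundedInverse (UnboundedOp.addScalar (ρ : ℂ) B))) := by
  have h := UnboundedOp.isSectorial_of_negSector_union_ball_subset hres hbound hδ hδlam
    (by linarith) hθ hθpi
  have hmain (t : ℝ) (ht : 0 ≤ t) := And.intro (h.integrableOn_balakrishnanIntegrand hα hα1 ht)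
    (h.isBoundedInverse_balakrishnan hα hα1 ht)
  refine ⟨h.keyholeIntegrable_cpow_smul (sub_neg.2 hα1), hmain, ?_⟩
  obtain ⟨hint, hinv⟩ := hmain 0 le_rfl
  have hker : EqOn (UnboundedOp.balakrishnanIntegrand B α 0) (fun ρ : ℝ =>
      ((ρ ^ (-α) : ℝ) : ℂ) • UnboundedOp.boundedInverse (UnboundedOp.addScalar (ρ : ℂ) B))
      (Ioi 0) := fun ρ hρ => by
    rw [UnboundedOp.balakrishnanIntegrand, UnboundedOp.fracKernel_zero_right hρ]
  rw [Complex.ofReal_zero, UnboundedOp.addScalar_zero, UnboundedOp.balakrishnan,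
    setIntegral_congr_fun measurableSet_Ioi hker] at hinv
  exact ⟨hint.congr_fun hker measurableSet_Ioi, hinv⟩
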